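/- **Setting.** Let $G$ be a compact simple Lie group, with irreducible reduced crystallographic root system $\Phi\subset V$, coroots $\Phi^\vee\subset V^\vee$ in the dual space (if $V$ is Euclidean, both spaces are identified with $\mathbb R^n$ by the scalar product and $\alpha^\vee=2\alpha/\langle\alpha,\alpha\rangle$), and simple roots $\alpha_1,\dots,\alpha_n$. Let $W$ be the Weyl group, generated by the simple reflections $r_1,\dots,r_n$, and $W^e=\{w\in W:\det w=1\}$. Let $Q^\vee=\bigoplus\mathbb Z\alpha_i^\vee$, $Q=\bigoplus\mathbb Z\alpha_i$, let $P^\vee=\bigoplus\mathbb Z\omega_i^\vee\subset V^\vee$ and $P=\bigoplus\mathbb Z\omega_i\subset V$ be the lattices spanned by the bases dual to $(\alpha_i)$ and to $(\alpha_i^\vee)$, and let $\xi=\sum m_i\alpha_i=-\alpha_0$ and $\eta=\sum m_i^\vee\alpha_i^\vee=-\alpha_0^\vee$ be the highest root and the highest coroot. Put $$F=\{a\in V^\vee:\langle\alpha_i,a\rangle\ge0\ (1\le i\le n),\ \langle\xi,a\rangle\le1\},\qquad F^\vee=\{a\in V:\langle a,\alpha_i^\vee\rangle\ge0\ (1\le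 i\le n),\ \langle a,\eta\rangle\le1\}.$$ Fix $j\in\{1,\dots,n\}$ and an integer $M\ge1$. Let $F_M$ and $\widetilde F_M$ be the sets of cosets in $\frac1MP^\vee/Q^\vee$ with a representative in $F$, respectively in $\operatorname{int}F$, and let $F^e_M$ be the set of those with a representative in $F\cup r_j\operatorname{int}F$. Likewise let $\Lambda_M$, $\widetilde\Lambda_M$, $\Lambda^e_M$ be the sets of cosets in $P/MQ$ with a representative in $MF^\vee$, in $M\operatorname{int}F^\vee$, and in $M(F^\vee\cup r_j\operatorname{int}F^\vee)$. Then $F^e_M=F_M\cup r_j\widetilde F_M$ and $\Lambda^e_M=\Lambda_M\cup r_j\widetilde\Lambda_M$. For $x\in V^\vee/Q^\vee$ and $\lambda\in V/MQ$ let $h^e_x=|\{w\in W^e:wx=x\}|$ and $h^{e\vee}_\lambda=|\{w\in W^e:w\lambda=\lambda\}|$. **Statement for $x\in F^e_M$.** 1. If $x\in r_j\widetilde F_M$, then $h^e_x=1$. 2. If $x\in F_M$, then $x$ is the class of a point $\sum_{i=1}^n\frac{s_i}M\omega_i^\vee$ with integers $s_0,\dots,s_n\ge0$ and $s_0+\sum_{i=1}^n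 s_im_i=M$. For any such coordinates: if all $s_0,\dots,s_n$ are non-zero, then $h^e_x=1$. 3. If some $s_i$ is zero, let $U$ be the subdiagram of the extended Dynkin diagram (nodes $0,\dots,n$ standing for $\alpha_0,\dots,\alpha_n$) on the nodes $i$ with $s_i=0$, and let $U_l$ be its connected components. Each $U_l$ is the (non-extended) Dynkin diagram of a compact simple Lie group $G_l$, and if $W_l$ is the Weyl group of $G_l$, then $$h^e_x=\tfrac12\prod_l|W_l|.$$ **Statement for $\lambda\in\Lambda^e_M$.** 1. If $\lambda\in r_j\widetilde\Lambda_M$, then $h^{e\vee}_\lambda=1$. 2. If $\lambda\in\Lambda_M$, then $\lambda$ is the class of a point $\sum_{i=1}^n t_i\omega_i$ with integers $t_0,\dots,t_n\ge0$ and $t_0+\sum_{i=1}^n t_im_i^\vee=M$. For any such coordinates: if all $t_0,\dots,t_n$ are non-zero, then $h^{e\vee}_\lambda=1$. 3. If some $t_i$ is zero, let $U'_l$ be the connected components of the subdiagram, on the nodes $i$ with $t_i=0$, of the dual extended Dynkin diagram (nodes $0,\dots,n$ standing for $\alpha_0^\vee,\dots,\alpha_n^\vee$). Each $U'_l$ is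 the (non-extended) Dynkin diagram of a compact simple Lie group $G'_l$, and if $W'_l$ is the Weyl group of $G'_l$, then $$h^{e\vee}_\lambda=\tfrac12\prod_l|W'_l|.$$ -/

import Mathlib

open RootPairing

universe u v w

namespace EvenTorus

/-- The data of a compact simple Lie group: an irreducible reduced crystallographic real root
system (finitely many roots spanning `Weight`, coroots spanning the dual space `Coweight`)
together with a choice of simple roots. -/
structure SimpleRootSystem where
  Index : Type u
  Weight : Type v
  Coweight : Type w
  [finite : Finite Index]
  [addCommGroupWeight : AddCommGroup Weight]
  [moduleWeight : Module ℝ Weight]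
  [addCommGroupCoweight : AddCommGroup Coweight]
  [moduleCoweight : Module ℝ Coweight]
  rootPairing : RootPairing Index ℝ Weight Coweight
  [isRootSystem : rootPairing.IsRootSystem]
  [isCrystallographic : rootPairing.IsCrystallographic]
  [isReduced : rootPairing.IsReduced]
  [isIrreducible : rootPairing.IsIrreducible]
  base : rootPairing.Base

attribute [instance] SimpleRootSystem.finite SimpleRootSystem.addCommGroupWeight
  SimpleRootSystem.moduleWeight SimpleRootSystem.addCommGroupCoweight
  SimpleRootSystem.moduleCoweight SimpleRootSystem.isRootSystem
  SimpleRootSystem.isCrystallographic SimpleRootSystem.isReduced SimpleRootSystem.isIrreducible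

noncomputable section

/-! Throughout, `M` contains the roots `α`, `N` contains the coroots `α^∨`, and the two spaces are
in duality by `P`. When `M = N` is a Euclidean space, `P` its scalar product and
`α^∨ = 2 α / ⟨α, α⟩`, these are the objects attached to a root system in a Euclidean space.
Everything below lives in `N`; the dual objects, which live in `M`, are obtained by applying the
same definitions to `P.flip` and `b.flip`, i.e. by exchanging roots and coroots. -/

section WeylGroup

variable {ι : Type u} {M : Type v} {N : Type w} [AddCommGroup M] [Module ℝ M] [AddCommGroup N]
  [Module ℝ N] {P : RootPairing ι ℝ M N}

/-- The Weyl group `W` as a group of linear maps of `N`, generated by the simple reflections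
`r_i a = a - ⟨α_i, a⟩ α_i^∨`. -/
def weylGroup (b : P.Base) : Subgroup (N ≃ₗ[ℝ] N) :=
  Subgroup.closure (Set.range fun i : b.support => P.coreflection i)

/-- The simple reflection `r_j`. -/
def simpleReflection (b : P.Base) (j : b.support) : weylGroup b :=
  ⟨P.coreflection j, Subgroup.subset_closure (Set.mem_range_self j)⟩

/-- The even Weyl group `W^e = {w ∈ W | det w = 1}`. -/
def evenWeylGroup (b : P.Base) : Subgroup (weylGroup b) :=
  (LinearEquiv.det.comp (weylGroup b).subtype).ker

theorem mem_evenWeylGroup (b : P.Base) (g : weylGroup b) :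
    g ∈ evenWeylGroup b ↔ LinearMap.det ((g : N ≃ₗ[ℝ] N) : N →ₗ[ℝ] N) = 1 := by
  rw [evenWeylGroup, MonoidHom.mem_ker, ← Units.val_inj]
  simp

/-- The dual root lattice `Q^∨ = ℤ α_1^∨ + ... + ℤ α_n^∨`. -/
def corootLattice (b : P.Base) : AddSubgroup N :=
  AddSubgroup.closure (P.coroot '' b.support)

/-- The dual weight lattice `P^∨ = {a | ⟨α, a⟩ ∈ ℤ for all simple α}`. -/
def coweightLattice (b : P.Base) : AddSubgroup N where
  carrier := {a | ∀ i ∈ b.support, ∃ z : ℤ, P.root' i a = z}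
  zero_mem' := fun i _ => ⟨0, by simp⟩
  add_mem' := fun {a c} ha hc i hi => by
    obtain ⟨y, hy⟩ := ha i hi
    obtain ⟨z, hz⟩ := hc i hi
    exact ⟨y + z, by rw [map_add, hy, hz]; push_cast; rfl⟩
  neg_mem' := fun {a} ha i hi => by
    obtain ⟨y, hy⟩ := ha i hi
    exact ⟨-y, by rw [map_neg, hy]; push_cast; rfl⟩

/-- `K L = {K a | a ∈ L}`. -/
def dilate (K : ℕ) (L : AddSubgroup N) : AddSubgroup N := L.map (nsmulAddMonoidHom K)

/-- `(1/K) L = {a | K a ∈ L}`, for `K > 0`. -/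
def contract (K : ℕ) (L : AddSubgroup N) : AddSubgroup N := L.comap (nsmulAddMonoidHom K)

/-- `L` is invariant under the Weyl group. -/
def IsStable (b : P.Base) (L : AddSubgroup N) : Prop :=
  ∀ g ∈ weylGroup b, ∀ a ∈ L, g a ∈ L

theorem isStable_dilate {b : P.Base} {L : AddSubgroup N} (hL : IsStable b L) (K : ℕ) :
    IsStable b (dilate K L) := by
  rintro g hg _ ⟨a, ha, rfl⟩
  exact ⟨g a, hL g hg a ha, by simp⟩

theorem isStable_corootLattice [P.IsCrystallographic] (b : P.Base) :
    IsStable b (corootLattice b) := by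
  have key : ∀ i : b.support, ∀ a ∈ corootLattice b, P.coreflection i a ∈ corootLattice b := by
    intro i a ha
    induction ha using AddSubgroup.closure_induction with
    | mem x hx =>
      obtain ⟨k, hk, rfl⟩ := hx
      rw [coreflection_apply_coroot, ← P.algebraMap_pairingIn ℤ, algebraMap_int_eq, eq_intCast,
        Int.cast_smul_eq_zsmul]
      exact sub_mem (AddSubgroup.subset_closure ⟨k, hk, rfl⟩)
        (zsmul_mem (AddSubgroup.subset_closure (Set.mem_image_of_mem P.coroot i.2)) _)
    | zero => rw [map_zero]; exact zero_mem _
    | add x y _ _ hx hy => rw [map_add]; exact add_mem hx hy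
    | neg x _ hx => rw [map_neg]; exact neg_mem hx
  intro g hg
  induction hg using Subgroup.closure_induction'' with
  | mem x hx => obtain ⟨i, rfl⟩ := hx; exact key i
  | inv_mem x hx => obtain ⟨i, rfl⟩ := hx; rw [coreflection_inv]; exact key i
  | one => exact fun a ha => ha
  | mul x y _ _ hx hy => exact fun a ha => hx _ (hy a ha)

/-- The action of `W` on the torus `N / L`: `g (a + L) = g a + L`. -/
def torusMap {b : P.Base} {L : AddSubgroup N} (hL : IsStable b L) (g : weylGroup b) :
    N ⧸ L →+ N ⧸ L :=
  QuotientAddGroup.map L L ((g : N ≃ₗ[ℝ] N) : N →+ N) (fun a ha => hL g g.2 a ha)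

/-- The order of the stabilizer `{g ∈ W^e | g x = x}` of a point `x` of the torus `N / L`. -/
def evenStabOrder {b : P.Base} {L : AddSubgroup N} (hL : IsStable b L) (x : N ⧸ L) : ℕ :=
  Nat.card {g : weylGroup b // g ∈ evenWeylGroup b ∧ torusMap hL g x = x}

/-- The cosets in `Λ / L` with a representative in `S`. -/
def grid (L Λ : AddSubgroup N) (S : Set N) : Set (N ⧸ L) :=
  {x | ∃ a ∈ Λ, a ∈ S ∧ (a : N ⧸ L) = x}

end WeylGroup

section Coweight

variable {ι : Type u} {M : Type v} {N : Type w} [AddCommGroup M] [Module ℝ M] [AddCommGroup N]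
  [Module ℝ N] {P : RootPairing ι ℝ M N} [P.IsRootSystem]

/-- The fundamental coweights `ω_i^∨`, the basis dual to the simple roots. -/
def fundamentalCoweight (b : P.Base) (i : b.support) : N :=
  P.toLinearMap.flip.toPerfPair.symm (b.toWeightBasis.coord i)

theorem root_fundamentalCoweight [DecidableEq ι] (b : P.Base) (k i : b.support) :
    P.root' k (fundamentalCoweight b i) = if k = i then 1 else 0 := by
  simp [fundamentalCoweight, Finsupp.single_apply]

end Coweight

section Alcove

variable {ι : Type u} {M : Type v} {N : Type w} [Finite ι] [AddCommGroup M] [Module ℝ M]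
  [AddCommGroup N] [Module ℝ N] {P : RootPairing ι ℝ M N} [P.IsRootSystem] [P.IsCrystallographic]
  [P.IsReduced] [P.IsIrreducible]

/-- There is a root `ξ` such that every `ξ - α`, `α` a root, is a sum of simple roots. -/
theorem exists_highestRoot (b : P.Base) :
    ∃ ξ : ι, ∀ i, P.root ξ - P.root i ∈ AddSubmonoid.closure (P.root '' b.support) := by
  classical
  have hne : Nonempty ι := by
    by_contra h
    rw [not_nonempty_iff] at h
    have h1 := IsRootSystem.span_root_eq_top (P := P)
    have := RootPairing.IsIrreducible.nontrivial P
    rw [Set.range_eq_empty, Submodule.span_empty] at h1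
    exact bot_ne_top h1
  have hraise : ∀ γ : ι, ∀ i ∈ b.support, P.pairingIn ℤ γ i < 0 → ∃ δ, b.height γ < b.height δ ∧
      P.root δ - P.root γ ∈ AddSubmonoid.closure (P.root '' b.support) := by
    intro γ i hi h
    have h1 : P.root (P.reflectionPerm i γ) = P.root γ + (-P.pairingIn ℤ γ i) • P.root i := by
      rw [root_reflectionPerm, neg_smul, reflection_apply_root' ℤ, sub_eq_add_neg]
    refine ⟨P.reflectionPerm i γ, ?_, ?_⟩
    · rw [b.height_add_zsmul h1, b.height_one_of_mem_support hi]
      simp only [smul_eq_mul]; omega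
    · obtain ⟨k, hk⟩ := Int.eq_ofNat_of_zero_le (a := -P.pairingIn ℤ γ i) (by omega)
      rw [h1, hk, add_sub_cancel_left, natCast_zsmul]
      exact nsmul_mem (AddSubmonoid.subset_closure (Set.mem_image_of_mem P.root hi)) k
  obtain ⟨θ, hθ⟩ := Finite.exists_max b.height
  have hpos : b.IsPos θ := by
    obtain ⟨i, hi⟩ := b.support_nonempty
    have := hθ i
    rw [b.height_one_of_mem_support hi] at this
    rw [Base.isPos_iff]; omega
  have hθdom : ∀ i ∈ b.support, 0 ≤ P.pairingIn ℤ θ i := by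
    intro i hi
    by_contra! h
    obtain ⟨δ, hδ, -⟩ := hraise θ i hi h
    exact absurd (hθ δ) (not_le.mpr hδ)
  obtain ⟨f, hf₀, hf₁, hf₂⟩ := b.exists_root_eq_sum_int θ
  replace hf₁ : 0 < f := by
    refine hf₁.resolve_right fun h => ?_
    rw [Base.isPos_iff, Base.height_eq_sum hf₂] at hpos
    exact absurd hpos (not_lt.mpr (Finset.sum_nonpos fun i _ ↦ h.le i))
  have hpair : ∀ j, P.pairingIn ℤ θ j = ∑ k ∈ b.support, f k * P.pairingIn ℤ k j := by
    intro j
    apply FaithfulSMul.algebraMap_injective ℤ ℝ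
    simp_rw [map_sum, map_mul, algebraMap_pairingIn, ← P.root_coroot'_eq_pairing]
    simp [hf₂]
  have hall : ∀ k : b.support, 0 < f k := by
    intro k
    obtain ⟨i, hi, hfi⟩ : ∃ i ∈ b.support, 0 < f i := by
      by_contra! h
      rw [Base.isPos_iff, Base.height_eq_sum hf₂] at hpos
      exact absurd hpos (not_lt.mpr (Finset.sum_nonpos h))
    refine b.induction_on_cartanMatrix (fun k => 0 < f k) (i := ⟨i, hi⟩) hfi ?_
    intro a c ha hca
    by_contra! hc
    have hc0 : f c = 0 := le_antisymm hc (hf₁.le c)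
    have hac : a ≠ c := by rintro rfl; omega
    have h1 : P.pairingIn ℤ θ c < 0 := by
      rw [hpair]
      refine Finset.sum_neg' (fun l hl => ?_) ⟨a, a.2, ?_⟩
      · by_cases hlc : l = c
        · subst hlc; rw [hc0]; simp
        · exact mul_nonpos_of_nonneg_of_nonpos (hf₁.le l) (b.pairingIn_le_zero_of_ne hlc hl c.2)
      · exact mul_neg_of_pos_of_neg ha (lt_of_le_of_ne (b.pairingIn_le_zero_of_ne
          (fun h => hac (Subtype.ext h)) a.2 c.2)
          ((mt (b.cartanMatrix_apply_eq_zero_iff_symm (i := a) (j := c)).1) hca))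
    exact absurd (hθdom c c.2) (not_le.mpr h1)
  refine ⟨θ, fun β => ?_⟩
  have : Nonempty {γ : ι // P.root γ - P.root β ∈ AddSubmonoid.closure (P.root '' b.support)} :=
    ⟨⟨β, by simp⟩⟩
  obtain ⟨⟨γ, hγβ⟩, hγ⟩ := Finite.exists_max
    (fun γ : {γ : ι // P.root γ - P.root β ∈ AddSubmonoid.closure (P.root '' b.support)} =>
      b.height γ)
  have hγdom : ∀ i ∈ b.support, 0 ≤ P.pairingIn ℤ i γ := by
    intro i hi
    by_contra! h
    rw [P.pairingIn_lt_zero_iff] at h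
    obtain ⟨δ, hδ, hδ'⟩ := hraise γ i hi h
    refine absurd (hγ ⟨δ, ?_⟩) (not_le.mpr hδ)
    have := add_mem hδ' hγβ
    rwa [sub_add_sub_cancel] at this
  by_cases hγθ : γ = θ
  · rwa [← hγθ]
  have hpos' : 0 < P.pairingIn ℤ θ γ := by
    obtain ⟨i, hi, hi0⟩ := b.exists_mem_support_pos_pairingIn_ne_zero γ
    rw [hpair]
    exact Finset.sum_pos' (fun l hl => mul_nonneg (hf₁.le l) (hγdom l hl))
      ⟨i, hi, mul_pos (hall ⟨i, hi⟩) (lt_of_le_of_ne (hγdom i hi) hi0.symm)⟩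
  obtain ⟨δ, hδ⟩ := P.root_sub_root_mem_of_pairingIn_pos hpos' (Ne.symm hγθ)
  have hh := b.height_sub hδ
  have hδpos : b.IsPos δ := by
    have h1 := hθ γ
    rw [Base.isPos_iff']; omega
  have h : P.root δ ∈ AddSubmonoid.closure (P.root '' b.support) := by
    refine hδpos.induction_on_add (p := fun k => P.root k ∈
      AddSubmonoid.closure (P.root '' b.support)) (fun i hi => AddSubmonoid.subset_closure
        ⟨i, hi, rfl⟩) (fun i j k hk hi hj => ?_)
    rw [hk]
    exact add_mem hi (AddSubmonoid.subset_closure ⟨j, hj, rfl⟩)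
  rw [hδ] at h
  have := add_mem h hγβ
  rwa [sub_add_sub_cancel] at this

/-- The highest root `ξ`. -/
def highestRoot (b : P.Base) : ι := (exists_highestRoot b).choose

/-- The marks: `ξ = m_1 α_1 + ... + m_n α_n`. -/
def mark (b : P.Base) (i : b.support) : ℝ := b.toWeightBasis.repr (P.root (highestRoot b)) i

/-- The nodes of the extended Dynkin diagram are `none` (the node `0`) and `some i` for the simple
roots `α_i`; they stand for the roots `α_0 = -ξ` and `α_i`. -/
def extendedNode (b : P.Base) : Option b.support → ι
  | none => P.reflectionPerm (highestRoot b) (highestRoot b)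
  | some i => i

theorem root_extendedNode_none (b : P.Base) :
    P.root (extendedNode b none) = -P.root (highestRoot b) := by
  simp [extendedNode]

/-- The Cartan integers `2⟨α_i, α_k⟩ / ⟨α_k, α_k⟩` of the extended Dynkin diagram. -/
def extendedCartan (b : P.Base) : Matrix (Option b.support) (Option b.support) ℤ :=
  .of fun i k => P.pairingIn ℤ (extendedNode b i) (extendedNode b k)

/-- The underlying graph of the subdiagram of the extended Dynkin diagram on the nodes `i` with
`s i = 0`: two distinct nodes are joined if their Cartan integers do not vanish. -/
def zeroGraph (b : P.Base) (s : Option b.support → ℕ) :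
    SimpleGraph {i : Option b.support // s i = 0} :=
  SimpleGraph.fromRel fun i k => extendedCartan b i k ≠ 0

/-- The connected component `c` of the subdiagram on the nodes with `s i = 0` is the
(non-extended) Dynkin diagram of `R`, that is, its nodes correspond to the simple roots of `R`
with the same Cartan integers. -/
def IsDynkinDiagram (b : P.Base) (s : Option b.support → ℕ)
    (c : (zeroGraph b s).ConnectedComponent) (R : SimpleRootSystem.{u, v, w}) : Prop :=
  ∃ e : R.base.support ≃ c.supp, ∀ i k : R.base.support,
    R.base.cartanMatrix i k = extendedCartan b (e i).1.1 (e k).1.1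

/-- The closed simplex `F = {a | ⟨α, a⟩ ≥ 0 for all simple α, ⟨ξ, a⟩ ≤ 1}`. -/
def alcove (b : P.Base) : Set N :=
  {a | (∀ i ∈ b.support, 0 ≤ P.root' i a) ∧ P.root' (highestRoot b) a ≤ 1}

/-- The interior `int(F)`. -/
def openAlcove (b : P.Base) : Set N :=
  {a | (∀ i ∈ b.support, 0 < P.root' i a) ∧ P.root' (highestRoot b) a < 1}

/-- `F^e = F ∪ r_j int(F)`. -/
def evenAlcove (b : P.Base) (j : b.support) : Set N :=
  alcove b ∪ P.coreflection j '' openAlcove b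

/-- The coordinates are nonnegative integers with `s_0 + s_1 m_1 + ... + s_n m_n = K`. -/
def IsCoordinate (b : P.Base) (K : ℕ) (s : Option b.support → ℕ) : Prop :=
  (s none : ℝ) + ∑ i : b.support, (s (some i) : ℝ) * mark b i = K

/-- The point `s_1 ω_1^∨ + ... + s_n ω_n^∨`. -/
def coordinatePoint (b : P.Base) (s : Option b.support → ℕ) : N :=
  ∑ i : b.support, (s (some i) : ℝ) • fundamentalCoweight b i

/-! The grids `F_K`, `F^e_K` in `N / Q^∨` and the order `h^e_x`. -/

/-- The cosets in `(1/K)P^∨ / Q^∨` with a representative in `S`: `F_K` for `S = F`, its interior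
for `S = int(F)`, and `F^e_K` for `S = F^e`. -/
def pointGrid (b : P.Base) (K : ℕ) (S : Set N) : Set (N ⧸ corootLattice b) :=
  grid (corootLattice b) (contract K (coweightLattice b)) S

/-- The reflection by `r_j` of the interior of `F_K`. -/
def reflectedPointGrid (b : P.Base) (K : ℕ) (j : b.support) : Set (N ⧸ corootLattice b) :=
  torusMap (isStable_corootLattice b) (simpleReflection b j) '' pointGrid b K (openAlcove b)

/-- `h^e_x`, for `x` in the torus `N / Q^∨`. -/
def hEven (b : P.Base) (x : N ⧸ corootLattice b) : ℕ :=
  evenStabOrder (isStable_corootLattice b) x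

/-- `s` are the coordinates of `x ∈ F_K`: `x` is the class of
`(s_1/K) ω_1^∨ + ... + (s_n/K) ω_n^∨`. -/
def IsPointCoordinate (b : P.Base) (K : ℕ) (s : Option b.support → ℕ)
    (x : N ⧸ corootLattice b) : Prop :=
  IsCoordinate b K s ∧ x = (((1 / K : ℝ) • coordinatePoint b s : N) : N ⧸ corootLattice b)

/-! The grids of weights. They are to be used for `b.flip`, for which `corootLattice` is the root
lattice `Q`, `coweightLattice` the weight lattice, `alcove` the simplex `F^∨`, `mark` the dual
marks and `fundamentalCoweight` the fundamental weights. -/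

/-- The cosets in `P^∨ / K Q^∨` with a representative in `K S`. -/
def weightGrid (b : P.Base) (K : ℕ) (S : Set N) : Set (N ⧸ dilate K (corootLattice b)) :=
  grid (dilate K (corootLattice b)) (coweightLattice b) ((fun a => (K : ℝ) • a) '' S)

/-- The reflection by `r_j` of the interior grid. -/
def reflectedWeightGrid (b : P.Base) (K : ℕ) (j : b.support) :
    Set (N ⧸ dilate K (corootLattice b)) :=
  torusMap (isStable_dilate (isStable_corootLattice b) K) (simpleReflection b j) ''
    weightGrid b K (openAlcove b)

/-- The order of the stabilizer in `W^e` of a point of `N / K Q^∨`. -/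
def hEvenWeight (b : P.Base) (K : ℕ) (x : N ⧸ dilate K (corootLattice b)) : ℕ :=
  evenStabOrder (isStable_dilate (isStable_corootLattice b) K) x

/-- `x` is the class of `t_1 ω_1^∨ + ... + t_n ω_n^∨`, where `t` are coordinates of level `K`. -/
def IsWeightCoordinate (b : P.Base) (K : ℕ) (t : Option b.support → ℕ)
    (x : N ⧸ dilate K (corootLattice b)) : Prop :=
  IsCoordinate b K t ∧ x = ((coordinatePoint b t : N) : N ⧸ dilate K (corootLattice b))

end Alcove

end

end EvenTorus

/-! An element `g` of W fixes the class of `a` exactly when `g a - a` lies in Q^∨. Composing `g`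
with the translation by `-(g a - a)` then gives an element of the affine Weyl group that fixes the
point `a` itself and has linear part `g`. So everything reduces to point stabilizers in the group
generated by the reflections in the n+1 walls of the alcove; that this group contains all
translations by Q^∨ is `coroot_mem_translations`.

For `a` in the closed alcove, an exchange argument (`exchange`, `mem_closure_of_fixes`) shows that
the affine stabilizer is generated by the reflections in the walls through `a`. Taking linear parts,
the stabilizer in W is generated by the reflections in the roots α_i of the extended diagram whose
wall contains `a` (`mem_reflectionSubgroup_iff`). The coordinates satisfy s_i / M = value of the
i-th wall function, so these are the nodes with s_i = 0. If there are none, the stabilizer is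
trivial; this also settles r_j int F, since stabilizers along an orbit are conjugate. If there is
one, the group contains a reflection, and its elements of determinant 1 form a subgroup of index
two: this is the factor 1/2.

The order of the full group is computed component by component. Different components are orthogonal
and each acts through its Cartan integers alone, so the group is the product of the Weyl groups W_l
(`card_reflectionSubgroup_eq_finprod`). That each component is a Dynkin diagram
(`exists_isDynkinDiagram`) follows by exhibiting its nodes as a base of the root system formed by
the roots in their span that are integral at `a`.

The statement on weights is the same one for the dual root system, after division by M. -/

namespace EvenTorus

noncomputable section

/-! ### Positive combinations of simple roots, and reflections in arbitrary roots. -/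

section Cone

variable {ι : Type u} {M : Type v} {N : Type w} [AddCommGroup M] [Module ℝ M] [AddCommGroup N]
  [Module ℝ N] {P : RootPairing ι ℝ M N}

/-- The nonnegative integral combinations of the simple roots. -/
def rootCone (b : P.Base) : AddSubmonoid M := AddSubmonoid.closure (P.root '' b.support)

theorem root_mem_rootCone {b : P.Base} {i : ι} (hi : i ∈ b.support) : P.root i ∈ rootCone b :=
  AddSubmonoid.subset_closure (Set.mem_image_of_mem _ hi)

theorem nonneg_of_mem_rootCone {b : P.Base} {a : N} (ha : ∀ i ∈ b.support, 0 ≤ P.root' i a)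
    {v : M} (hv : v ∈ rootCone b) : 0 ≤ P.toLinearMap v a := by
  induction hv using AddSubmonoid.closure_induction with
  | mem x hx => obtain ⟨i, hi, rfl⟩ := hx; exact ha i hi
  | zero => simp
  | add x y _ _ hx hy => rw [map_add, LinearMap.add_apply]; exact add_nonneg hx hy

theorem mem_rootCone_of_isPos [Finite ι] [P.IsCrystallographic] {b : P.Base} {i : ι}
    (hi : b.IsPos i) : P.root i ∈ rootCone b :=
  hi.induction_on_add (p := fun k => P.root k ∈ rootCone b) (fun i hi => root_mem_rootCone hi)
    (fun i j k hk hi hj => by rw [hk]; exact add_mem hi (root_mem_rootCone hj))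

theorem eq_zero_or_pos_of_mem_rootCone {b : P.Base} {a : N} (ha : ∀ i ∈ b.support, 0 < P.root' i a)
    {v : M} (hv : v ∈ rootCone b) : v = 0 ∨ 0 < P.toLinearMap v a := by
  induction hv using AddSubmonoid.closure_induction with
  | mem x hx => obtain ⟨i, hi, rfl⟩ := hx; exact Or.inr (ha i hi)
  | zero => simp
  | add x y _ _ hx hy =>
    rw [map_add, LinearMap.add_apply]
    rcases hx with rfl | hx
    · simpa using hy
    · rcases hy with rfl | hy
      · simpa using Or.inr hx
      · exact Or.inr (add_pos hx hy)

theorem root_pos_of_mem_rootCone {b : P.Base} {a : N} (ha : ∀ i ∈ b.support, 0 < P.root' i a)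
    {i : ι} (hi : P.root i ∈ rootCone b) : 0 < P.root' i a :=
  (eq_zero_or_pos_of_mem_rootCone ha hi).resolve_left (P.ne_zero i)

theorem coreflection_mem_weylGroup_of_mem_support (b : P.Base) {i : ι} (hi : i ∈ b.support) :
    P.coreflection i ∈ weylGroup b :=
  Subgroup.subset_closure ⟨⟨i, hi⟩, rfl⟩

theorem coreflection_reflectionPerm_eq (i j : ι) : P.coreflection (P.reflectionPerm j i) =
    P.coreflection j * P.coreflection i * P.coreflection j := by
  have := P.flip.reflection_reflectionPerm (i := i) (j := j)
  ext a
  exact LinearEquiv.congr_fun this a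

theorem coreflection_mem_weylGroup [Finite ι] [P.IsCrystallographic] [P.IsReduced] (b : P.Base)
    (i : ι) : P.coreflection i ∈ weylGroup b := by
  induction i using b.induction_reflect with
  | h₀ i h =>
    rw [coreflection_reflectionPerm_eq]
    exact mul_mem (mul_mem h h) h
  | h₁ i hi => exact coreflection_mem_weylGroup_of_mem_support b hi
  | h₂ i j h hj =>
    have := coreflection_mem_weylGroup_of_mem_support b hj
    rw [coreflection_reflectionPerm_eq]
    exact mul_mem (mul_mem this h) this

theorem root_reflectionPerm_self (i : ι) : P.root (P.reflectionPerm i i) = -P.root i := by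
  rw [root_reflectionPerm, reflection_apply_self]

theorem coroot_reflectionPerm_self (i : ι) : P.coroot (P.reflectionPerm i i) = -P.coroot i := by
  rw [coroot_reflectionPerm, coreflection_apply_self]

theorem coreflection_reflectionPerm_self (i : ι) :
    P.coreflection (P.reflectionPerm i i) = P.coreflection i := by
  ext a
  rw [coreflection_apply, coreflection_apply, RootPairing.root', root_reflectionPerm_self,
    coroot_reflectionPerm_self, map_neg, LinearMap.neg_apply, neg_smul_neg]

theorem reflectionPerm_reflectionPerm_self (i j : ι) :
    P.reflectionPerm (P.reflectionPerm i i) j = P.reflectionPerm i j := by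
  apply P.coroot.injective
  rw [coroot_reflectionPerm, coreflection_reflectionPerm_self, coroot_reflectionPerm]

theorem root'_reflectionPerm_self (i : ι) (a : N) :
    P.root' (P.reflectionPerm i i) a = - P.root' i a := by
  simp [RootPairing.root']

variable [P.IsRootSystem]

/-- The sum of the fundamental coweights is positive on every simple root, hence on every nonzero
element of the cone. -/
theorem rootCone_antisymm {b : P.Base} {v : M} (hv : v ∈ rootCone b) (hv' : -v ∈ rootCone b) :
    v = 0 := by
  classical
  have h : ∀ i ∈ b.support, 0 < P.root' i (∑ k : b.support, fundamentalCoweight b k) := by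
    intro i hi
    rw [map_sum, Finset.sum_congr rfl
      (fun k _ => root_fundamentalCoweight b ⟨i, hi⟩ k)]
    simp
  rcases eq_zero_or_pos_of_mem_rootCone h hv with h1 | h1
  · exact h1
  · have := nonneg_of_mem_rootCone (fun i hi => (h i hi).le) hv'
    rw [map_neg, LinearMap.neg_apply] at this
    linarith

theorem apply_eq_sum_repr (b : P.Base) (v : M) (a : N) :
    P.toLinearMap v a = ∑ i : b.support, b.toWeightBasis.repr v i * P.root' i a := by
  conv_lhs => rw [← b.toWeightBasis.sum_repr v]
  simp [map_sum, LinearMap.sum_apply]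

theorem exists_nat_repr_of_mem_rootCone {b : P.Base} {v : M} (hv : v ∈ rootCone b)
    (k : b.support) : ∃ n : ℕ, b.toWeightBasis.repr v k = n := by
  classical
  induction hv using AddSubmonoid.closure_induction with
  | mem x hx =>
    obtain ⟨i, hi, rfl⟩ := hx
    have := b.toWeightBasis_repr_root ⟨i, hi⟩
    simp only at this
    rw [this, Finsupp.single_apply]
    split_ifs
    · exact ⟨1, by simp⟩
    · exact ⟨0, by simp⟩
  | zero => exact ⟨0, by simp⟩
  | add x y _ _ hx hy =>
    obtain ⟨m, hm⟩ := hx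
    obtain ⟨n, hn⟩ := hy
    exact ⟨m + n, by simp [hm, hn]⟩

theorem isPos_of_mem_rootCone [Finite ι] [P.IsCrystallographic] {b : P.Base} {i : ι}
    (hi : P.root i ∈ rootCone b) : b.IsPos i := by
  by_contra h
  have h1 := (Base.IsPos.or_neg b i).resolve_left h
  have h2 : P.root (P.reflectionPerm i i) ∈ rootCone b := mem_rootCone_of_isPos h1
  rw [root_reflectionPerm_self] at h2
  exact P.ne_zero i (rootCone_antisymm hi h2)

theorem ext_of_root'_eq (b : P.Base) {a c : N} (h : ∀ i ∈ b.support, P.root' i a = P.root' i c) :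
    a = c := by
  apply P.toLinearMap.flip.toPerfPair.injective
  ext v
  change P.toLinearMap v a = P.toLinearMap v c
  rw [apply_eq_sum_repr b, apply_eq_sum_repr b]
  exact Finset.sum_congr rfl fun i _ => by rw [h i i.2]

end Cone

/-! ### The highest root and the bounds it imposes on the alcove. -/

section HighestRoot

variable {ι : Type u} {M : Type v} {N : Type w} [Finite ι] [AddCommGroup M] [Module ℝ M]
  [AddCommGroup N] [Module ℝ N] {P : RootPairing ι ℝ M N} [P.IsRootSystem] [P.IsCrystallographic]
  [P.IsReduced] [P.IsIrreducible]

theorem highestRoot_sub_mem (b : P.Base) (i : ι) :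
    P.root (highestRoot b) - P.root i ∈ rootCone b := (exists_highestRoot b).choose_spec i

theorem support_nonempty (b : P.Base) : b.support.Nonempty := by
  have : Nonempty ι := ⟨highestRoot b⟩
  exact b.support_nonempty

theorem root_highestRoot_mem (b : P.Base) : P.root (highestRoot b) ∈ rootCone b := by
  obtain ⟨i, hi⟩ := support_nonempty b
  simpa using add_mem (highestRoot_sub_mem b i) (root_mem_rootCone hi)

theorem exists_nat_mark (b : P.Base) (i : b.support) : ∃ n : ℕ, 0 < n ∧ mark b i = n := by
  obtain ⟨n, hn⟩ := exists_nat_repr_of_mem_rootCone (highestRoot_sub_mem b i) i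
  refine ⟨n + 1, n.succ_pos, ?_⟩
  rw [map_sub, Finsupp.sub_apply, b.toWeightBasis_repr_root, Finsupp.single_eq_same] at hn
  rw [mark]
  push_cast
  linarith

theorem mark_pos (b : P.Base) (i : b.support) : 0 < mark b i := by
  obtain ⟨n, hn, h⟩ := exists_nat_mark b i
  rw [h]
  exact_mod_cast hn

theorem root'_highestRoot (b : P.Base) (a : N) :
    P.root' (highestRoot b) a = ∑ i : b.support, mark b i * P.root' i a :=
  apply_eq_sum_repr b _ a

/-- Otherwise reflecting ξ in the simple root would add a positive multiple of that root to ξ,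
giving a root above the highest one. -/
theorem pairing_simple_highestRoot_nonneg (b : P.Base) {i : ι} (hi : i ∈ b.support) :
    0 ≤ P.pairingIn ℤ i (highestRoot b) := by
  by_contra! h
  rw [P.pairingIn_lt_zero_iff] at h
  have h1 := highestRoot_sub_mem b (P.reflectionPerm i (highestRoot b))
  rw [root_reflectionPerm, reflection_apply_root' ℤ, sub_sub_cancel] at h1
  obtain ⟨n, hn⟩ := exists_nat_repr_of_mem_rootCone h1 ⟨i, hi⟩
  have h2 := b.toWeightBasis_repr_root ⟨i, hi⟩
  simp only at h2
  rw [map_zsmul, h2, Finsupp.smul_apply, Finsupp.single_eq_same, zsmul_eq_mul, mul_one] at hn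
  have : (P.pairingIn ℤ (highestRoot b) i : ℝ) < 0 := by exact_mod_cast h
  have : (0 : ℝ) ≤ n := n.cast_nonneg
  linarith

theorem pairing_highestRoot_nonneg (b : P.Base) {i : ι} (hi : P.root i ∈ rootCone b) :
    0 ≤ P.pairingIn ℤ i (highestRoot b) := by
  have : 0 ≤ P.root' i (P.coroot (highestRoot b)) := by
    refine nonneg_of_mem_rootCone (fun k hk => ?_) hi
    rw [root'_coroot_eq_pairing, ← P.algebraMap_pairingIn ℤ]
    simpa using pairing_simple_highestRoot_nonneg b hk
  rw [root'_coroot_eq_pairing, ← P.algebraMap_pairingIn ℤ] at this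
  simpa using this

/-- If the pairing of α with ξ^∨ were n + 2, then -r_ξ α = (n + 2)ξ - α would be a root, so α - (n +
1)ξ would lie in the cone. Adding nξ puts α - ξ there too, and ξ - α already is, forcing α = ξ. -/
theorem pairing_highestRoot_le_one (b : P.Base) {i : ι} (hi : i ≠ highestRoot b) :
    P.pairingIn ℤ i (highestRoot b) ≤ 1 := by
  by_contra! h
  obtain ⟨n, hn⟩ : ∃ n : ℕ, P.pairingIn ℤ i (highestRoot b) = n + 2 :=
    ⟨(P.pairingIn ℤ i (highestRoot b) - 2).toNat, by omega⟩
  have h1 := highestRoot_sub_mem b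
    (P.reflectionPerm (highestRoot b) (P.reflectionPerm i i))
  have h2 : P.root i - P.root (highestRoot b) ∈ rootCone b := by
    have h3 := nsmul_mem (root_highestRoot_mem b) n
    convert! add_mem h1 h3 using 1
    rw [root_reflectionPerm, root_reflectionPerm, reflection_apply_self, map_neg,
      reflection_apply_root' ℤ, hn]
    rw [add_smul, natCast_zsmul, two_zsmul]
    abel
  have h3 := rootCone_antisymm h2 (by simpa using highestRoot_sub_mem b i)
  exact hi (P.root.injective (sub_eq_zero.1 h3))

theorem openAlcove_subset_alcove (b : P.Base) : openAlcove b ⊆ alcove b :=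
  fun _ ha => ⟨fun i hi => (ha.1 i hi).le, ha.2.le⟩

theorem root'_le_one_of_mem_alcove {b : P.Base} {a : N} (ha : a ∈ alcove b) (i : ι) :
    P.root' i a ≤ 1 := by
  have := nonneg_of_mem_rootCone ha.1 (highestRoot_sub_mem b i)
  rw [map_sub, LinearMap.sub_apply] at this
  exact le_trans (by linarith) ha.2

theorem root'_lt_one_of_mem_openAlcove {b : P.Base} {a : N} (ha : a ∈ openAlcove b) (i : ι) :
    P.root' i a < 1 := by
  have := nonneg_of_mem_rootCone (openAlcove_subset_alcove b ha).1 (highestRoot_sub_mem b i)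
  rw [map_sub, LinearMap.sub_apply] at this
  exact lt_of_le_of_lt (by linarith) ha.2

theorem neg_one_lt_of_mem_openAlcove {b : P.Base} {a : N} (ha : a ∈ openAlcove b) (i : ι) :
    -1 < P.root' i a := by
  have := root'_lt_one_of_mem_openAlcove ha (P.reflectionPerm i i)
  rw [root'_reflectionPerm_self] at this
  linarith

theorem openAlcove_nonempty (b : P.Base) : (openAlcove b).Nonempty := by
  classical
  set S : ℝ := ∑ k : b.support, mark b k with hS
  have hSpos : 0 ≤ S := Finset.sum_nonneg fun k _ => (mark_pos b k).le
  -- All n+1 wall functions take the same value 1/(S + 1) here, because 1 - S/(S + 1) = 1/(S + 1).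
  set a : N := (1 / (S + 1)) • ∑ k : b.support, fundamentalCoweight b k with ha
  have h1 : ∀ i : b.support, P.root' i a = 1 / (S + 1) := by
    intro i
    rw [ha, map_smul, map_sum, Finset.sum_congr rfl
      (fun k _ => root_fundamentalCoweight b i k)]
    simp
  refine ⟨a, fun i hi => ?_, ?_⟩
  · rw [h1 ⟨i, hi⟩]
    positivity
  · rw [root'_highestRoot]
    simp_rw [h1]
    rw [← Finset.sum_mul, ← hS, mul_one_div, div_lt_one (by positivity)]
    linarith

end HighestRoot

theorem affineEquiv_mul_apply {N : Type*} [AddCommGroup N] [Module ℝ N] (s t : N ≃ᵃ[ℝ] N) (a : N) :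
    (s * t) a = s (t a) := rfl

/-! ### Affine roots, the exchange condition, and stabilizers of points of the alcove. -/

section AffineReflection

variable {ι : Type u} {M : Type v} {N : Type w} [Finite ι] [AddCommGroup M] [Module ℝ M]
  [AddCommGroup N] [Module ℝ N] {P : RootPairing ι ℝ M N} [P.IsRootSystem] [P.IsCrystallographic]
  [P.IsReduced] [P.IsIrreducible]

/-- The constant term of the affine function attached to a node of the extended diagram. -/
def level {S : Type*} : Option S → ℤ
  | none => 1
  | some _ => 0

/-- The affine functions `⟨α_i, a⟩` and `1 - ⟨ξ, a⟩` that cut out the alcove. -/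
def wall (b : P.Base) (e : Option b.support) (a : N) : ℝ :=
  P.root' (extendedNode b e) a + level e

theorem wall_some (b : P.Base) (i : b.support) (a : N) : wall b (some i) a = P.root' i a := by
  simp [wall, level, extendedNode]

theorem wall_none (b : P.Base) (a : N) : wall b none a = 1 - P.root' (highestRoot b) a := by
  rw [wall, extendedNode, root'_reflectionPerm_self]
  simp only [level]
  push_cast
  ring

theorem mem_alcove_iff_wall (b : P.Base) (a : N) : a ∈ alcove b ↔ ∀ e, 0 ≤ wall b e a := by
  simp [Option.forall, wall_some, wall_none, alcove, and_comm]

theorem mem_openAlcove_iff_wall (b : P.Base) (a : N) : a ∈ openAlcove b ↔ ∀ e, 0 < wall b e a := by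
  simp [Option.forall, wall_some, wall_none, openAlcove, and_comm]

/-- The reflections in the walls of the alcove. -/
def wallReflection (b : P.Base) (e : Option b.support) : N ≃ᵃ[ℝ] N :=
  AffineEquiv.constVAdd ℝ N (-(level e : ℝ) • P.coroot (extendedNode b e)) *
    (P.coreflection (extendedNode b e)).toAffineEquiv

theorem wallReflection_apply (b : P.Base) (e : Option b.support) (a : N) :
    wallReflection b e a = a - wall b e a • P.coroot (extendedNode b e) := by
  rw [wallReflection, affineEquiv_mul_apply, wall]
  simp only [LinearEquiv.coe_toAffineEquiv, AffineEquiv.constVAdd_apply, vadd_eq_add,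
    coreflection_apply]
  module

theorem linearHom_wallReflection (b : P.Base) (e : Option b.support) :
    AffineEquiv.linearHom (wallReflection b e) = P.coreflection (extendedNode b e) := by
  ext a
  change (P.coreflection (extendedNode b e)).toAffineEquiv.linear a = _
  rfl

theorem root'_wallReflection (b : P.Base) (e : Option b.support) (i : ι) (a : N) :
    P.root' i (wallReflection b e a) = P.root' (P.reflectionPerm (extendedNode b e) i) a -
      (level e * P.pairingIn ℤ i (extendedNode b e) : ℤ) := by
  have h := P.algebraMap_pairingIn ℤ i (extendedNode b e)
  rw [algebraMap_int_eq, eq_intCast] at h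
  rw [wallReflection_apply, map_sub, map_smul, root'_coroot_eq_pairing, wall, ← h]
  have h1 : P.root' (P.reflectionPerm (extendedNode b e) i) a =
      P.root' i a - P.pairing i (extendedNode b e) * P.root' (extendedNode b e) a := by
    simp [RootPairing.root', reflection_apply_root]
  rw [h1, ← h, smul_eq_mul]
  push_cast
  ring

theorem wall_wallReflection_self (b : P.Base) (e : Option b.support) (a : N) :
    wall b e (wallReflection b e a) = - wall b e a := by
  rw [wallReflection_apply, wall, map_sub, map_smul, root'_coroot_eq_pairing, pairing_same,
    smul_eq_mul, wall]
  ring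

theorem wallReflection_mul_self (b : P.Base) (e : Option b.support) :
    wallReflection b e * wallReflection b e = 1 := by
  ext a
  rw [affineEquiv_mul_apply, wallReflection_apply, wall_wallReflection_self, wallReflection_apply]
  simp

theorem wallReflection_apply_eq_self {b : P.Base} {e : Option b.support} {a : N}
    (h : wall b e a = 0) : wallReflection b e a = a := by
  rw [wallReflection_apply, h, zero_smul, sub_zero]

/-- On the open alcove every root takes a nonzero value strictly between -1 and 1, which no integer
can cancel. This gives every affine root a definite sign at ρ. -/
theorem affineRoot_ne_zero {b : P.Base} {ρ : N} (hρ : ρ ∈ openAlcove b) (i : ι) (k : ℤ) :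
    P.root' i ρ + k ≠ 0 := by
  intro h
  have h1 := root'_lt_one_of_mem_openAlcove hρ i
  have h2 := neg_one_lt_of_mem_openAlcove hρ i
  have h3 : -1 < (k : ℝ) := by linarith
  have h4 : (k : ℝ) < 1 := by linarith
  have h5 : -1 < k := by exact_mod_cast h3
  have h6 : k < 1 := by exact_mod_cast h4
  obtain rfl : k = 0 := by omega
  rcases b.root_mem_or_neg_mem i with hi | hi
  · have := root_pos_of_mem_rootCone hρ.1 hi
    simp at h
    linarith
  · have := (eq_zero_or_pos_of_mem_rootCone hρ.1 hi).resolve_left (neg_ne_zero.2 (P.ne_zero i))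
    rw [map_neg, LinearMap.neg_apply] at this
    simp at h
    linarith

/-- An affine root that is positive on the open alcove has a nonnegative linear part and constant
term or a negative linear part and a positive constant term. -/
theorem affineRoot_pos {b : P.Base} {ρ : N} (hρ : ρ ∈ openAlcove b) {i : ι} {k : ℤ}
    (h : 0 < P.root' i ρ + k) :
    (P.root i ∈ rootCone b ∧ 0 ≤ k) ∨ (-P.root i ∈ rootCone b ∧ 1 ≤ k) := by
  rcases b.root_mem_or_neg_mem i with hi | hi
  · refine Or.inl ⟨hi, ?_⟩
    have := root'_lt_one_of_mem_openAlcove hρ i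
    have : (-1 : ℝ) < k := by linarith
    have : -1 < k := by exact_mod_cast this
    omega
  · refine Or.inr ⟨hi, ?_⟩
    have := nonneg_of_mem_rootCone (openAlcove_subset_alcove b hρ).1 hi
    rw [map_neg, LinearMap.neg_apply] at this
    have : (0 : ℝ) < k := by linarith
    have : 0 < k := by exact_mod_cast this
    omega

/-- The sign at a single interior point determines the weak sign on the whole closed alcove; the
dichotomy of `affineRoot_pos` replaces a connectedness argument. -/
theorem affineRoot_nonneg {b : P.Base} {ρ a : N} (hρ : ρ ∈ openAlcove b) (ha : a ∈ alcove b)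
    {i : ι} {k : ℤ} (h : 0 < P.root' i ρ + k) : 0 ≤ P.root' i a + k := by
  rcases affineRoot_pos hρ h with ⟨hi, hk⟩ | ⟨hi, hk⟩
  · have := nonneg_of_mem_rootCone ha.1 hi
    have : (0 : ℝ) ≤ k := by exact_mod_cast hk
    exact add_nonneg ‹_› ‹_›
  · have h1 := root'_le_one_of_mem_alcove ha (P.reflectionPerm i i)
    rw [root'_reflectionPerm_self] at h1
    have : (1 : ℝ) ≤ k := by exact_mod_cast hk
    linarith

theorem affineRoot_nonpos {b : P.Base} {ρ a : N} (hρ : ρ ∈ openAlcove b) (ha : a ∈ alcove b)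
    {i : ι} {k : ℤ} (h : P.root' i ρ + k < 0) : P.root' i a + k ≤ 0 := by
  have := affineRoot_nonneg hρ ha (i := P.reflectionPerm i i) (k := -k)
    (by rw [root'_reflectionPerm_self]; push_cast; linarith)
  rw [root'_reflectionPerm_self] at this
  push_cast at this
  linarith

/-- An affine root whose sign changes under a wall reflection is the one of that wall. -/
theorem affineRoot_eq_wall {b : P.Base} {ρ : N} (hρ : ρ ∈ openAlcove b) {e : Option b.support}
    {i : ι} {k : ℤ} (h : 0 < P.root' i ρ + k) (h' : P.root' i (wallReflection b e ρ) + k < 0) :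
    i = extendedNode b e ∧ k = level e := by
  have hk := affineRoot_pos hρ h
  rw [root'_wallReflection] at h'
  rcases e with _ | m
  · simp only [level, extendedNode, one_mul] at h' ⊢
    -- Reflecting in the wall 0 changes the constant term to k + ⟨α, ξ^∨⟩, and the new linear part
    -- exceeds -1 at ρ; so a negative value forces k + ⟨α, ξ^∨⟩ < 1. For α positive this leaves only
    -- k = ⟨α, ξ^∨⟩ = 0, where nothing changes.
    have hlow := neg_one_lt_of_mem_openAlcove hρ (P.reflectionPerm
      (P.reflectionPerm (highestRoot b) (highestRoot b)) i)
    rw [reflectionPerm_reflectionPerm_self] at h' hlow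
    have hc : P.pairingIn ℤ i (P.reflectionPerm (highestRoot b) (highestRoot b)) =
        -P.pairingIn ℤ i (highestRoot b) := by simp
    rw [hc] at h'
    set θ := highestRoot b
    have h1 : (k : ℝ) + P.pairingIn ℤ i θ < 1 := by push_cast at h'; linarith
    have h2 : k + P.pairingIn ℤ i θ < 1 := by exact_mod_cast h1
    have hneg : P.pairingIn ℤ (P.reflectionPerm i i) θ = -P.pairingIn ℤ i θ := by simp
    have hzero : P.pairingIn ℤ i θ = 0 → k = 0 → False := by
      intro h0 hk0
      have h3 : P.root' (P.reflectionPerm θ i) ρ = P.root' i ρ := by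
        have : P.pairing i θ = 0 := by rw [← P.algebraMap_pairingIn ℤ, h0]; simp
        simp [RootPairing.root', reflection_apply_root, this]
      rw [h3, h0, hk0] at h'
      rw [hk0] at h
      simp at h h'
      linarith
    rcases hk with ⟨hi, hk⟩ | ⟨hi, hk⟩
    · have : 0 ≤ P.pairingIn ℤ i θ := pairing_highestRoot_nonneg b hi
      exact (hzero (by omega) (by omega)).elim
    · have hi' : P.root (P.reflectionPerm i i) ∈ rootCone b := by rwa [root_reflectionPerm_self]
      have h3 : 0 ≤ P.pairingIn ℤ (P.reflectionPerm i i) θ := pairing_highestRoot_nonneg b hi'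
      by_cases hiθ : P.reflectionPerm i i = θ
      · have h4 : i = P.reflectionPerm θ θ := by
          apply P.root.injective
          rw [root_reflectionPerm_self, ← hiθ, root_reflectionPerm_self, neg_neg]
        refine ⟨h4, ?_⟩
        by_contra hk1
        have h6 : (2 : ℝ) ≤ k := by exact_mod_cast (show (2 : ℤ) ≤ k by omega)
        have h7 : P.pairingIn ℤ i θ = -2 := by
          rw [hiθ, P.pairingIn_same] at hneg
          omega
        have h8 : P.root' (P.reflectionPerm θ i) ρ = P.root' θ ρ := by
          rw [h4, P.reflectionPerm_self]
        have h9 := root_pos_of_mem_rootCone hρ.1 (root_highestRoot_mem b)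
        rw [h8, h7] at h'
        push_cast at h'
        linarith
      -- With -α a positive root other than ξ, the only remaining values are k = 1 and ⟨α, ξ^∨⟩ =
      -- -1. The reflected value is then that of ξ - (-α) at ρ, which is not negative.
      · have h4 : P.pairingIn ℤ (P.reflectionPerm i i) θ ≤ 1 := pairing_highestRoot_le_one b hiθ
        have h5 : k = 1 ∧ P.pairingIn ℤ i θ = -1 := by omega
        have h6 : P.root' (P.reflectionPerm θ i) ρ =
            P.root' θ ρ - P.root' (P.reflectionPerm i i) ρ := by
          have : P.pairing i θ = -1 := by rw [← P.algebraMap_pairingIn ℤ, h5.2]; simp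
          simp [RootPairing.root', reflection_apply_root, this]
          ring
        have h7 := nonneg_of_mem_rootCone (openAlcove_subset_alcove b hρ).1
          (highestRoot_sub_mem b (P.reflectionPerm i i))
        rw [map_sub, LinearMap.sub_apply] at h7
        rw [h6, h5.1, h5.2] at h'
        push_cast at h'
        linarith
  · simp only [level, extendedNode, zero_mul, Int.cast_zero, sub_zero] at h' ⊢
    rcases hk with ⟨hi, hk⟩ | ⟨hi, hk⟩
    · have hk' : (0 : ℝ) ≤ k := by exact_mod_cast hk
      by_cases him : i = m
      · refine ⟨him, ?_⟩
        by_contra hk0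
        have h1 : (1 : ℝ) ≤ k := by exact_mod_cast (show (1 : ℤ) ≤ k by omega)
        have := neg_one_lt_of_mem_openAlcove hρ (P.reflectionPerm m i)
        linarith
      -- A simple reflection keeps every positive root other than its own positive.
      · have h1 := mem_rootCone_of_isPos ((isPos_of_mem_rootCone hi).reflectionPerm m.2 him)
        have := root_pos_of_mem_rootCone hρ.1 h1
        linarith
    · have h1 : (1 : ℝ) ≤ k := by exact_mod_cast hk
      have := neg_one_lt_of_mem_openAlcove hρ (P.reflectionPerm m i)
      linarith

/-- Affine roots pull back to affine roots. The coroot is carried along because it turns an equality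
of pulled-back affine roots into a conjugation of reflections in `wallReflection_mul_eq`. -/
theorem exists_affineRoot_comp {b : P.Base} {t : N ≃ᵃ[ℝ] N}
    (ht : t ∈ Submonoid.closure (Set.range (wallReflection b))) (i : ι) (k : ℤ) :
    ∃ j : ι, ∃ l : ℤ, (∀ a, P.root' i (t a) + k = P.root' j a + l) ∧
      t.linear (P.coroot j) = P.coroot i := by
  induction ht using Submonoid.closure_induction_right with
  | one => exact ⟨i, k, fun a => rfl, rfl⟩
  | mul_right t ht s hs ih =>
    obtain ⟨e, rfl⟩ := hs
    obtain ⟨j, l, h1, h2⟩ := ih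
    refine ⟨P.reflectionPerm (extendedNode b e) j,
      l - level e * P.pairingIn ℤ j (extendedNode b e), fun a => ?_, ?_⟩
    · rw [affineEquiv_mul_apply, h1, root'_wallReflection]
      push_cast
      ring
    · have h3 : (t * wallReflection b e).linear = t.linear * P.coreflection (extendedNode b e) := by
        rw [← linearHom_wallReflection]
        rfl
      rw [h3, LinearEquiv.mul_apply, coroot_reflectionPerm, coreflection_same, h2]

theorem prod_wallReflection_mem (b : P.Base) (l : List (Option b.support)) :
    (l.map (wallReflection b)).prod ∈ Submonoid.closure (Set.range (wallReflection b)) := by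
  refine Submonoid.list_prod_mem _ fun x hx => ?_
  obtain ⟨e, -, rfl⟩ := List.mem_map.1 hx
  exact Submonoid.subset_closure ⟨e, rfl⟩

/-- If a wall separates the alcoves of `ρ` and `t * s_m ρ` but not those of `ρ` and `t ρ`, then
its reflection is the conjugate of `s_m` by `t`. -/
theorem wallReflection_mul_eq {b : P.Base} {ρ : N} (hρ : ρ ∈ openAlcove b) {t : N ≃ᵃ[ℝ] N}
    (ht : t ∈ Submonoid.closure (Set.range (wallReflection b))) {e m : Option b.support}
    (h : 0 < wall b e (t ρ)) (h' : wall b e (t (wallReflection b m ρ)) < 0) :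
    wallReflection b e * t = t * wallReflection b m := by
  obtain ⟨j, l, h1, h2⟩ := exists_affineRoot_comp ht (extendedNode b e) (level e)
  obtain ⟨rfl, rfl⟩ := affineRoot_eq_wall hρ (e := m) (i := j) (k := l)
    (by rw [← h1]; exact h) (by rw [← h1]; exact h')
  ext a
  rw [affineEquiv_mul_apply, affineEquiv_mul_apply, wallReflection_apply, wallReflection_apply,
    ← h2]
  have h3 : wall b e (t a) = wall b m a := h1 a
  rw [h3, ← map_smul, sub_eq_neg_add, sub_eq_neg_add, ← vadd_eq_add, ← vadd_eq_add, t.map_vadd,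
    map_neg]

/-- The wall function is positive at ρ and negative at the image of ρ under the whole word, so it
changes sign between two consecutive prefixes. There the reflection in the wall is conjugate to the
letter being added, and multiplying by it deletes that letter. -/
theorem exchange {b : P.Base} {ρ : N} (hρ : ρ ∈ openAlcove b) (e : Option b.support)
    (l : List (Option b.support)) (h : wall b e ((l.map (wallReflection b)).prod ρ) < 0) :
    ∃ l' : List (Option b.support), l'.length + 1 = l.length ∧
      wallReflection b e * (l.map (wallReflection b)).prod = (l'.map (wallReflection b)).prod := by
  induction l using List.reverseRecOn with
  | nil => exact absurd h (not_lt.2 ((mem_openAlcove_iff_wall b ρ).1 hρ e).le)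
  | append_singleton l m ih =>
    simp only [List.map_append, List.map_cons, List.map_nil, List.prod_append, List.prod_singleton,
      List.length_append, List.length_singleton] at h ⊢
    obtain ⟨j, k, h1, -⟩ := exists_affineRoot_comp (prod_wallReflection_mem b l)
      (extendedNode b e) (level e)
    rcases lt_or_gt_of_ne (affineRoot_ne_zero hρ j k) with h2 | h2
    · obtain ⟨l', hl, hl'⟩ := ih (by rw [wall, h1]; exact h2)
      refine ⟨l' ++ [m], by simp [hl], ?_⟩
      simp [← hl', mul_assoc]
    · refine ⟨l, rfl, ?_⟩
      rw [← mul_assoc, wallReflection_mul_eq hρ (prod_wallReflection_mem b l)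
        (by rw [wall, h1]; exact h2) h, mul_assoc, wallReflection_mul_self, mul_one]

/-- Induction on the length of a word t s_m. If t also keeps ρ inside, then t = 1 and s_m alone
moves ρ across its wall, which is impossible. Otherwise some wall e separates ρ from t ρ; then t s_m
= s_e t, and exchange rewrites s_e t as a shorter word. -/
theorem eq_one_of_mem_openAlcove {b : P.Base} {ρ : N} (hρ : ρ ∈ openAlcove b)
    (l : List (Option b.support)) (h : ∀ e, 0 < wall b e ((l.map (wallReflection b)).prod ρ)) :
    (l.map (wallReflection b)).prod = 1 := by
  induction hn : l.length using Nat.strong_induction_on generalizing l with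
  | _ n ih =>
    rcases l.eq_nil_or_concat' with rfl | ⟨l, m, rfl⟩
    · rfl
    · set t := (l.map (wallReflection b)).prod with ht
      have hm : ((l ++ [m]).map (wallReflection b)).prod = t * wallReflection b m := by simp [ht]
      have hlen : l.length + 1 = n := by simpa using hn
      by_cases hall : ∀ e, 0 < wall b e (t ρ)
      · have h1 := ih l.length (by omega) l hall rfl
        rw [hm] at h
        have h2 := h m
        rw [ht, h1, one_mul, wall_wallReflection_self] at h2
        have h3 := (mem_openAlcove_iff_wall b ρ).1 hρ m
        linarith
      · push Not at hall
        obtain ⟨e, he⟩ := hall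
        obtain ⟨j, k, h1, -⟩ := exists_affineRoot_comp (prod_wallReflection_mem b l)
          (extendedNode b e) (level e)
        have he' : wall b e (t ρ) < 0 := by
          refine lt_of_le_of_ne he ?_
          rw [wall, h1]
          exact affineRoot_ne_zero hρ j k
        have h2 : wallReflection b e * (t * wallReflection b m) =
            t * wallReflection b m * wallReflection b m := by
          refine wallReflection_mul_eq hρ ?_ ?_ ?_
          · rw [← hm]
            exact prod_wallReflection_mem b _
          · rw [← hm]
            exact h e
          · rw [← affineEquiv_mul_apply, mul_assoc, wallReflection_mul_self, mul_one]
            exact he'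
        rw [mul_assoc t, wallReflection_mul_self, mul_one] at h2
        obtain ⟨l', hl, hl'⟩ := exchange hρ e l he'
        have h3 : t * wallReflection b m = (l'.map (wallReflection b)).prod := by
          rw [← hl', ← ht, ← congrArg (wallReflection b e * ·) h2, ← mul_assoc,
            wallReflection_mul_self, one_mul]
        rw [hm, h3] at h ⊢
        exact ih l'.length (by omega) l' h rfl

/-- In the group generated by the wall reflections, the stabilizer of a point of the alcove is
generated by the reflections in the walls that contain it. -/
theorem mem_closure_of_fixes {b : P.Base} {a : N} (ha : a ∈ alcove b)
    (l : List (Option b.support)) (h : (l.map (wallReflection b)).prod a = a) :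
    (l.map (wallReflection b)).prod ∈
      Subgroup.closure (wallReflection b '' {e | wall b e a = 0}) := by
  obtain ⟨ρ, hρ⟩ := openAlcove_nonempty b
  induction hn : l.length using Nat.strong_induction_on generalizing l with
  | _ n ih =>
    set t := (l.map (wallReflection b)).prod with ht
    by_cases hall : ∀ e, 0 < wall b e (t ρ)
    · rw [ht, eq_one_of_mem_openAlcove hρ l hall]
      exact one_mem _
    · push Not at hall
      obtain ⟨e, he⟩ := hall
      obtain ⟨j, k, h1, -⟩ := exists_affineRoot_comp (prod_wallReflection_mem b l)
        (extendedNode b e) (level e)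
      have he' : P.root' j ρ + k < 0 := by
        refine lt_of_le_of_ne ?_ (affineRoot_ne_zero hρ j k)
        rw [← h1]
        exact he
      -- The pulled-back affine root is negative at ρ, hence nonpositive at `a`, where its value is
      -- that of the wall function at t a = a. Since `a` is in the alcove, the separating wall
      -- passes through `a`, and its reflection can be stripped off t while still fixing `a`.
      have h2 := affineRoot_nonpos hρ ha he'
      rw [← h1, h] at h2
      have h3 : wall b e a = 0 := le_antisymm h2 ((mem_alcove_iff_wall b a).1 ha e)
      obtain ⟨l', hl, hl'⟩ := exchange hρ e l (by rw [wall, h1]; exact he')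
      have h4 := ih l'.length (by omega) l' (by
        rw [← hl', affineEquiv_mul_apply, ← ht, h, wallReflection_apply_eq_self h3]) rfl
      rw [← hl'] at h4
      have h5 := mul_mem (Subgroup.subset_closure (Set.mem_image_of_mem (wallReflection b) h3)) h4
      rwa [← mul_assoc, wallReflection_mul_self, one_mul] at h5

end AffineReflection

theorem card_eq_two_mul_card_ker {G : Type*} [Group G] (d : G →* ℝˣ)
    (h : ∀ g, d g = 1 ∨ d g = -1) (h' : ∃ g, d g = -1) : Nat.card G = 2 * Nat.card d.ker := by
  have h1 : (d.range : Set ℝˣ) = {1, -1} := by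
    ext x
    constructor
    · rintro ⟨g, rfl⟩
      exact h g
    · rintro (rfl | rfl)
      · exact ⟨1, map_one d⟩
      · exact h'
  have h2 : Nat.card d.range = 2 := by
    have h3 : (1 : ℝˣ) ≠ -1 := by
      intro h4
      have := congrArg Units.val h4
      norm_num at this
    change Nat.card (d.range : Set ℝˣ) = 2
    rw [h1, Nat.card_coe_set_eq, Set.ncard_pair h3]
  rw [← Subgroup.card_mul_index d.ker, Subgroup.index_ker, h2, mul_comm]

/-! ### Determinants on reflection groups, and stabilizers on the torus. -/

section Generated

variable {ι : Type u} {M : Type v} {N : Type w} [AddCommGroup M] [Module ℝ M]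
  [AddCommGroup N] [Module ℝ N] {P : RootPairing ι ℝ M N}

/-- The group generated by the reflections in the roots with index in `S`. -/
def reflectionSubgroup (P : RootPairing ι ℝ M N) (S : Set ι) : Subgroup (N ≃ₗ[ℝ] N) :=
  Subgroup.closure (P.coreflection '' S)

theorem det_coreflection [FiniteDimensional ℝ N] (i : ι) :
    LinearEquiv.det (P.coreflection i) = -1 := by
  rw [← Units.val_inj]
  have h : ((P.coreflection i : N ≃ₗ[ℝ] N) : N →ₗ[ℝ] N) =
      LinearMap.transvection (-P.root' i) (P.coroot i) := by
    ext a
    simp [coreflection_apply, LinearMap.transvection, sub_eq_add_neg]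
  rw [LinearEquiv.coe_det, h, LinearMap.transvection.det]
  simp
  norm_num

theorem det_of_mem_reflectionSubgroup [FiniteDimensional ℝ N] {S : Set ι} {g : N ≃ₗ[ℝ] N}
    (hg : g ∈ reflectionSubgroup P S) : LinearEquiv.det g = 1 ∨ LinearEquiv.det g = -1 := by
  induction hg using Subgroup.closure_induction with
  | mem x hx => obtain ⟨i, -, rfl⟩ := hx; exact Or.inr (det_coreflection i)
  | one => simp
  | mul x y _ _ hx hy =>
    rw [map_mul]
    rcases hx with hx | hx <;> rcases hy with hy | hy <;> simp [hx, hy]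
  | inv x _ hx => rw [map_inv]; rcases hx with hx | hx <;> simp [hx]

/-- The origin of the factor 1/2: as soon as one reflection is present, the determinant maps onto
{1, -1}. -/
theorem card_reflectionSubgroup [FiniteDimensional ℝ N] {S : Set ι} (hS : S.Nonempty) :
    Nat.card (reflectionSubgroup P S) =
      2 * Nat.card {g : N ≃ₗ[ℝ] N // g ∈ reflectionSubgroup P S ∧
        LinearMap.det (g : N →ₗ[ℝ] N) = 1} := by
  obtain ⟨i, hi⟩ := hS
  rw [card_eq_two_mul_card_ker (LinearEquiv.det.comp (reflectionSubgroup P S).subtype)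
    (fun g => det_of_mem_reflectionSubgroup g.2)
    ⟨⟨P.coreflection i, Subgroup.subset_closure ⟨i, hi, rfl⟩⟩, det_coreflection i⟩]
  congr 1
  refine Nat.card_congr ⟨fun g => ⟨g.1.1, g.1.2, ?_⟩, fun g => ⟨⟨g.1, g.2.1⟩, ?_⟩,
    fun g => rfl, fun g => rfl⟩
  · have := g.2
    rw [MonoidHom.mem_ker, ← Units.val_inj] at this
    simpa using this
  · rw [MonoidHom.mem_ker, ← Units.val_inj]
    simpa using g.2.2

theorem torusMap_eq_self_iff {b : P.Base} {L : AddSubgroup N} (hL : IsStable b L) (g : weylGroup b)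
    (a : N) : torusMap hL g (a : N ⧸ L) = (a : N ⧸ L) ↔ (g : N ≃ₗ[ℝ] N) a - a ∈ L := by
  change (((g : N ≃ₗ[ℝ] N) a : N) : N ⧸ L) = (a : N ⧸ L) ↔ _
  rw [eq_comm, QuotientAddGroup.eq, neg_add_eq_sub]

theorem evenStabOrder_eq_card {b : P.Base} {L : AddSubgroup N} (hL : IsStable b L) (a : N)
    {H : Subgroup (N ≃ₗ[ℝ] N)}
    (hH : ∀ g, g ∈ weylGroup b ∧ g a - a ∈ L ↔ g ∈ H) :
    evenStabOrder hL (a : N ⧸ L) =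
      Nat.card {g : N ≃ₗ[ℝ] N // g ∈ H ∧ LinearMap.det (g : N →ₗ[ℝ] N) = 1} := by
  refine Nat.card_congr ⟨fun g => ⟨g.1, (hH _).1 ⟨g.1.2, ?_⟩, ?_⟩,
    fun g => ⟨⟨g.1, ((hH _).2 g.2.1).1⟩, ?_, ?_⟩, fun g => rfl, fun g => rfl⟩
  · exact (torusMap_eq_self_iff hL _ _).1 g.2.2
  · exact (mem_evenWeylGroup b _).1 g.2.1
  · exact (mem_evenWeylGroup b _).2 g.2.2
  · exact (torusMap_eq_self_iff hL _ _).2 ((hH _).2 g.2.1).2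

/-- The stabilizer of the image under `h` is the conjugate by `h` of the stabilizer of the class of
`a`, which is trivial. -/
theorem evenStabOrder_torusMap {b : P.Base} {L : AddSubgroup N} (hL : IsStable b L)
    (h : weylGroup b) (a : N) (ha : ∀ g ∈ weylGroup b, g a - a ∈ L → g = 1) :
    evenStabOrder hL (torusMap hL h (a : N ⧸ L)) = 1 := by
  have h1 : torusMap hL h (a : N ⧸ L) = (((h : N ≃ₗ[ℝ] N) a : N) : N ⧸ L) := rfl
  rw [h1, evenStabOrder_eq_card hL (H := ⊥)]
  · have : Unique {g : N ≃ₗ[ℝ] N // g ∈ (⊥ : Subgroup (N ≃ₗ[ℝ] N)) ∧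
        LinearMap.det (g : N →ₗ[ℝ] N) = 1} :=
      { default := ⟨1, one_mem _, LinearMap.det_id⟩
        uniq := fun g => Subtype.ext (Subgroup.mem_bot.1 g.2.1) }
    exact Nat.card_unique
  · intro g
    rw [Subgroup.mem_bot]
    constructor
    · rintro ⟨hg, hga⟩
      have h2 : (h : N ≃ₗ[ℝ] N)⁻¹ * g * h ∈ weylGroup b :=
        mul_mem (mul_mem (inv_mem h.2) hg) h.2
      have h3 := hL _ (inv_mem h.2) _ hga
      have h4 := ha _ h2 (by
        rw [map_sub] at h3
        convert! h3 using 2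
        exact ((h : N ≃ₗ[ℝ] N).symm_apply_apply a).symm)
      rw [mul_assoc, inv_mul_eq_one] at h4
      exact mul_eq_right.1 h4.symm
    · rintro rfl
      exact ⟨one_mem _, by simp⟩

theorem coroot_mem_corootLattice (b : P.Base) (i : ι) : P.coroot i ∈ corootLattice b := by
  have h : AddSubmonoid.closure (P.coroot '' b.support) ≤ (corootLattice b).toAddSubmonoid := by
    rw [AddSubmonoid.closure_le]
    exact AddSubgroup.subset_closure
  rcases b.coroot_mem_or_neg_mem i with hi | hi
  · exact h hi
  · exact neg_mem_iff.1 (h hi)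

end Generated

/-! ### Translations in the affine Weyl group, and the linear stabilizer. -/

section AffineWeylGroup

variable {ι : Type u} {M : Type v} {N : Type w} [Finite ι] [AddCommGroup M] [Module ℝ M]
  [AddCommGroup N] [Module ℝ N] {P : RootPairing ι ℝ M N} [P.IsRootSystem] [P.IsCrystallographic]
  [P.IsReduced] [P.IsIrreducible]

/-- The affine Weyl group, generated by the reflections in the walls of the alcove. -/
def affineWeylGroup (b : P.Base) : Subgroup (N ≃ᵃ[ℝ] N) :=
  Subgroup.closure (Set.range (wallReflection b))

theorem toAffineEquiv_mul (g h : N ≃ₗ[ℝ] N) :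
    (g * h).toAffineEquiv = g.toAffineEquiv * h.toAffineEquiv := rfl

theorem toAffineEquiv_mem (b : P.Base) {g : N ≃ₗ[ℝ] N} (hg : g ∈ weylGroup b) :
    g.toAffineEquiv ∈ affineWeylGroup b := by
  have h1 : ∀ i : b.support, (P.coreflection i).toAffineEquiv ∈ affineWeylGroup b := by
    intro i
    have h2 : (P.coreflection i).toAffineEquiv = wallReflection b (some i) := by
      ext a
      rw [wallReflection_apply, wall_some]
      rfl
    rw [h2]
    exact Subgroup.subset_closure ⟨_, rfl⟩
  induction hg using Subgroup.closure_induction'' with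
  | mem x hx => obtain ⟨i, rfl⟩ := hx; exact h1 i
  | inv_mem x hx => obtain ⟨i, rfl⟩ := hx; rw [coreflection_inv]; exact h1 i
  | one => exact one_mem _
  | mul x y _ _ hx hy => rw [toAffineEquiv_mul]; exact mul_mem hx hy

/-- The vectors whose translation lies in the affine Weyl group. -/
def translations (b : P.Base) : AddSubgroup N where
  carrier := {q | AffineEquiv.constVAdd ℝ N q ∈ affineWeylGroup b}
  zero_mem' := by
    simp only [Set.mem_ofPred_eq, AffineEquiv.constVAdd_zero]
    exact one_mem _
  add_mem' := fun {p q} hp hq => by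
    simp only [Set.mem_ofPred_eq, AffineEquiv.constVAdd_add] at hp hq ⊢
    exact mul_mem hp hq
  neg_mem' := fun {q} hq => by
    simp only [Set.mem_ofPred_eq, ← AffineEquiv.constVAdd_symm] at hq ⊢
    exact inv_mem hq

theorem mem_translations {b : P.Base} {q : N} :
    q ∈ translations b ↔ AffineEquiv.constVAdd ℝ N q ∈ affineWeylGroup b := Iff.rfl

theorem coroot_highestRoot_mem_translations (b : P.Base) :
    P.coroot (highestRoot b) ∈ translations b := by
  have h1 := toAffineEquiv_mem b (coreflection_mem_weylGroup b (highestRoot b))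
  have h2 : wallReflection b none ∈ affineWeylGroup b := Subgroup.subset_closure ⟨_, rfl⟩
  rw [mem_translations]
  convert! mul_mem h2 h1 using 1
  ext a
  rw [affineEquiv_mul_apply, wallReflection_apply, wall_none, extendedNode,
    coroot_reflectionPerm_self]
  simp only [AffineEquiv.constVAdd_apply, vadd_eq_add, LinearEquiv.coe_toAffineEquiv,
    coreflection_apply, map_sub, map_smul, root'_coroot_eq_pairing, pairing_same, smul_eq_mul]
  module

theorem apply_mem_translations {b : P.Base} {g : N ≃ₗ[ℝ] N} (hg : g ∈ weylGroup b) {q : N}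
    (hq : q ∈ translations b) : g q ∈ translations b := by
  rw [mem_translations] at hq ⊢
  have h1 := toAffineEquiv_mem b hg
  convert! mul_mem (mul_mem h1 hq) (inv_mem h1) using 1
  ext a
  rw [affineEquiv_mul_apply, affineEquiv_mul_apply]
  simp only [AffineEquiv.constVAdd_apply, vadd_eq_add, LinearEquiv.coe_toAffineEquiv, map_add]
  congr 1
  exact (g.apply_symm_apply a).symm

/-- The two reflections in parallel hyperplanes for ξ give the translation by ξ^∨. The set `G`
contains ξ and is stable under reflections, so by irreducibility its coroots span, and some β in `G`
is not orthogonal to the given root α. Unless α = ±β, the bound in `G` gives ⟨α, β^∨⟩ = ±1, so β^∨ -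
r_α β^∨ = ±α^∨ is a translation as well. -/
theorem coroot_mem_translations (b : P.Base) (j : ι) : P.coroot j ∈ translations b := by
  set G : Set ι := {i | P.coroot i ∈ translations b ∧ ∀ j, j ≠ i → P.pairingIn ℤ j i ≤ 1}
  have hξ : highestRoot b ∈ G :=
    ⟨coroot_highestRoot_mem_translations b, fun j hj => pairing_highestRoot_le_one b hj⟩
  have hstab : ∀ k, ∀ i ∈ G, P.reflectionPerm k i ∈ G := by
    intro k i hi
    refine ⟨?_, fun j hj => ?_⟩
    · rw [coroot_reflectionPerm]
      exact apply_mem_translations (coreflection_mem_weylGroup b k) hi.1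
    · have h1 := hi.2 (P.reflectionPerm k j) (fun h => hj (by rw [← h, P.reflectionPerm_self]))
      have h2 : P.pairingIn ℤ (P.reflectionPerm k j) i = P.pairingIn ℤ j (P.reflectionPerm k i) := by
        apply FaithfulSMul.algebraMap_injective ℤ ℝ
        rw [P.algebraMap_pairingIn, P.algebraMap_pairingIn, pairing_reflectionPerm]
      rwa [← h2]
  have htop : Submodule.span ℝ (P.coroot '' G) = ⊤ := by
    refine IsIrreducible.eq_top_of_invtSubmodule_coreflection (P := P) _ (fun k => ?_) ?_
    · rw [Module.End.mem_invtSubmodule, Submodule.span_le]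
      rintro _ ⟨i, hi, rfl⟩
      exact Submodule.subset_span ⟨_, hstab k i hi, coroot_reflectionPerm P k i⟩
    · intro h
      have : P.coroot (highestRoot b) ∈ Submodule.span ℝ (P.coroot '' G) :=
        Submodule.subset_span ⟨_, hξ, rfl⟩
      rw [h, Submodule.mem_bot] at this
      exact P.ne_zero' _ this
  obtain ⟨i, hi, hij⟩ : ∃ i ∈ G, P.pairingIn ℤ j i ≠ 0 := by
    by_contra! h
    have h1 : Submodule.span ℝ (P.coroot '' G) ≤ LinearMap.ker (P.root' j) := by
      rw [Submodule.span_le]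
      rintro _ ⟨i, hi, rfl⟩
      rw [SetLike.mem_coe, LinearMap.mem_ker, root'_coroot_eq_pairing, ← P.algebraMap_pairingIn ℤ,
        h i hi, map_zero]
    rw [htop] at h1
    have h2 := h1 (x := P.coroot j) Submodule.mem_top
    rw [LinearMap.mem_ker, root'_coroot_eq_pairing, pairing_same] at h2
    norm_num at h2
  by_cases h1 : j = i
  · rw [h1]; exact hi.1
  by_cases h2 : P.reflectionPerm j j = i
  · have := hi.1
    rw [← h2, coroot_reflectionPerm_self] at this
    exact neg_mem_iff.1 this
  have h3 := hi.2 j h1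
  have h4 := hi.2 _ h2
  have h5 : P.pairingIn ℤ (P.reflectionPerm j j) i = -P.pairingIn ℤ j i := by simp
  have h6 := sub_mem hi.1 (apply_mem_translations (coreflection_mem_weylGroup b j) hi.1)
  rw [coreflection_apply_coroot, sub_sub_cancel, ← P.algebraMap_pairingIn ℤ, algebraMap_int_eq,
    eq_intCast, Int.cast_smul_eq_zsmul] at h6
  rcases (by omega : P.pairingIn ℤ j i = 1 ∨ P.pairingIn ℤ j i = -1) with h7 | h7
  · simpa [h7] using h6
  · simpa [h7] using h6

theorem corootLattice_le_translations (b : P.Base) : corootLattice b ≤ translations b := by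
  rw [corootLattice, AddSubgroup.closure_le]
  rintro _ ⟨i, -, rfl⟩
  exact coroot_mem_translations b i

theorem exists_list_of_mem_affineWeylGroup {b : P.Base} {t : N ≃ᵃ[ℝ] N}
    (ht : t ∈ affineWeylGroup b) :
    ∃ l : List (Option b.support), t = (l.map (wallReflection b)).prod := by
  induction ht using Subgroup.closure_induction'' with
  | mem x hx => obtain ⟨e, rfl⟩ := hx; exact ⟨[e], by simp⟩
  | inv_mem x hx =>
    obtain ⟨e, rfl⟩ := hx
    exact ⟨[e], by simp [inv_eq_iff_mul_eq_one, wallReflection_mul_self]⟩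
  | one => exact ⟨[], rfl⟩
  | mul x y _ _ hx hy =>
    obtain ⟨l, rfl⟩ := hx
    obtain ⟨l', rfl⟩ := hy
    exact ⟨l ++ l', by simp⟩

/-- The stabilizer in the Weyl group of the class of a point `a` of the alcove is generated by the
reflections in the roots of the walls that contain `a`. -/
theorem mem_reflectionSubgroup_iff {b : P.Base} {a : N} (ha : a ∈ alcove b) (g : N ≃ₗ[ℝ] N) :
    g ∈ weylGroup b ∧ g a - a ∈ corootLattice b ↔
      g ∈ reflectionSubgroup P (extendedNode b '' {e | wall b e a = 0}) := by
  constructor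
  · rintro ⟨hg, hga⟩
    have h1 := corootLattice_le_translations b hga
    have h2 := mul_mem (inv_mem (mem_translations.1 h1)) (toAffineEquiv_mem b hg)
    obtain ⟨l, hl⟩ := exists_list_of_mem_affineWeylGroup h2
    -- The translation corrects `g` to an affine map fixing `a`; its linear part is still `g`, so
    -- `linearHom` carries the affine generators to the linear ones.
    have h3 : ((AffineEquiv.constVAdd ℝ N (g a - a))⁻¹ * g.toAffineEquiv) a = a := by
      change (AffineEquiv.constVAdd ℝ N (g a - a)).symm (g a) = a
      rw [AffineEquiv.constVAdd_symm]
      simp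
    have h4 := mem_closure_of_fixes ha l (by rw [← hl, h3])
    rw [← hl] at h4
    have h5 := Subgroup.mem_map_of_mem AffineEquiv.linearHom h4
    rw [MonoidHom.map_closure, Set.image_image] at h5
    simp_rw [linearHom_wallReflection] at h5
    rw [reflectionSubgroup, Set.image_image]
    exact h5
  · intro hg
    induction hg using Subgroup.closure_induction'' with
    | mem x hx =>
      obtain ⟨_, ⟨e, he, rfl⟩, rfl⟩ := hx
      refine ⟨coreflection_mem_weylGroup b _, ?_⟩
      have h1 : P.root' (extendedNode b e) a = (-level e : ℤ) := by
        rw [Set.mem_ofPred_eq, wall] at he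
        push_cast
        linarith
      rw [coreflection_apply, h1, sub_sub_cancel_left, Int.cast_smul_eq_zsmul]
      exact neg_mem (zsmul_mem (coroot_mem_corootLattice b _) _)
    | inv_mem x hx =>
      obtain ⟨_, ⟨e, he, rfl⟩, rfl⟩ := hx
      rw [coreflection_inv]
      refine ⟨coreflection_mem_weylGroup b _, ?_⟩
      have h1 : P.root' (extendedNode b e) a = (-level e : ℤ) := by
        rw [Set.mem_ofPred_eq, wall] at he
        push_cast
        linarith
      rw [coreflection_apply, h1, sub_sub_cancel_left, Int.cast_smul_eq_zsmul]
      exact neg_mem (zsmul_mem (coroot_mem_corootLattice b _) _)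
    | one => exact ⟨one_mem _, by simp⟩
    | mul x y _ _ hx hy =>
      refine ⟨mul_mem hx.1 hy.1, ?_⟩
      have h1 := add_mem (isStable_corootLattice b x hx.1 _ hy.2) hx.2
      rw [map_sub, sub_add_sub_cancel] at h1
      exact h1

end AffineWeylGroup

/-! ### The reflection group of orthogonal blocks as a product of Weyl groups. -/

section Product

variable {ι : Type u} {M : Type v} {N : Type w} [AddCommGroup M] [Module ℝ M]
  [AddCommGroup N] [Module ℝ N] {P : RootPairing ι ℝ M N}

theorem map_mem_of_simpleReflection_mem (b : P.Base) {G : Type*} [Group G] (φ : weylGroup b →* G)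
    (K : Subgroup G) (h : ∀ i, φ (simpleReflection b i) ∈ K) (g : weylGroup b) : φ g ∈ K := by
  have h1 : ∀ x (hx : x ∈ weylGroup b), φ ⟨x, hx⟩ ∈ K := by
    intro x hx
    induction hx using Subgroup.closure_induction with
    | mem x hx => obtain ⟨i, rfl⟩ := hx; exact h i
    | one => exact (map_one φ).symm ▸ one_mem K
    | mul x y hx hy ihx ihy => exact (map_mul φ ⟨x, hx⟩ ⟨y, hy⟩).symm ▸ mul_mem ihx ihy
    | inv x hx ihx => exact (map_inv φ ⟨x, hx⟩).symm ▸ inv_mem ihx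
  exact h1 g g.2

section Block

variable (P) (R : SimpleRootSystem.{u, v, w}) (f : R.base.support → ι)

/-- The linear map that sends the simple coroots of `R` to the coroots with index given by `f`. -/
def blockEmbedding : R.Coweight →ₗ[ℝ] N :=
  R.base.toCoweightBasis.constr ℝ fun i => P.coroot (f i)

theorem blockEmbedding_coroot (i : R.base.support) :
    blockEmbedding P R f (R.rootPairing.coroot i) = P.coroot (f i) := by
  rw [← R.base.toCoweightBasis_apply, blockEmbedding, Module.Basis.constr_basis]

/-- The linear map that matches the simple roots of `R` with the roots with index given by `f`. -/
def blockProjection : N →ₗ[ℝ] R.Coweight :=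
  ∑ i : R.base.support, (P.root' (f i)).smulRight (fundamentalCoweight R.base i)

theorem root'_blockProjection (i : R.base.support) (a : N) :
    R.rootPairing.root' i (blockProjection P R f a) = P.root' (f i) a := by
  classical
  rw [blockProjection, LinearMap.sum_apply, map_sum]
  simp_rw [LinearMap.smulRight_apply, map_smul]
  rw [Finset.sum_congr rfl (fun k _ => by rw [root_fundamentalCoweight R.base i k])]
  simp

variable [P.IsCrystallographic]

/-- Only Cartan integers enter: the composite is determined by pairings of simple roots with simple
coroots. Hence any root system with the given Dynkin diagram can serve as a model for the block. -/
theorem blockProjection_blockEmbedding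
    (h : ∀ i k : R.base.support, R.base.cartanMatrix i k = P.pairingIn ℤ (f i) (f k))
    (x : R.Coweight) : blockProjection P R f (blockEmbedding P R f x) = x := by
  have h1 : blockProjection P R f ∘ₗ blockEmbedding P R f = LinearMap.id := by
    refine R.base.toCoweightBasis.ext fun k => ?_
    rw [LinearMap.comp_apply, R.base.toCoweightBasis_apply, blockEmbedding_coroot,
      LinearMap.id_apply]
    refine ext_of_root'_eq R.base fun i hi => ?_
    rw [root'_blockProjection P R f ⟨i, hi⟩, root'_coroot_eq_pairing, root'_coroot_eq_pairing,
      ← P.algebraMap_pairingIn ℤ, ← h, ← R.rootPairing.algebraMap_pairingIn ℤ]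
    rfl
  exact LinearMap.congr_fun h1 x

theorem blockProjection_blockEmbedding_eq_zero (R' : SimpleRootSystem.{u, v, w})
    (f' : R'.base.support → ι) (h : ∀ i k, P.pairingIn ℤ (f i) (f' k) = 0)
    (x : R'.Coweight) : blockProjection P R f (blockEmbedding P R' f' x) = 0 := by
  have h1 : blockProjection P R f ∘ₗ blockEmbedding P R' f' = 0 := by
    refine R'.base.toCoweightBasis.ext fun k => ?_
    rw [LinearMap.comp_apply, R'.base.toCoweightBasis_apply, blockEmbedding_coroot,
      LinearMap.zero_apply]
    refine ext_of_root'_eq R.base fun i hi => ?_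
    rw [root'_blockProjection P R f ⟨i, hi⟩, root'_coroot_eq_pairing,
      ← P.algebraMap_pairingIn ℤ, h, map_zero, map_zero]
  exact LinearMap.congr_fun h1 x

end Block

section Blocks

variable (P) [P.IsCrystallographic] {γ : Type*} [Fintype γ] (R : γ → SimpleRootSystem.{u, v, w})
  (f : ∀ c, (R c).base.support → ι)

/-- The blocks `f c` have the Cartan integers of `R c` and are mutually orthogonal. -/
structure AreBlocks : Prop where
  cartan : ∀ c i k, (R c).base.cartanMatrix i k = P.pairingIn ℤ (f c i) (f c k)
  orthogonal : ∀ c d, c ≠ d → ∀ i k, P.pairingIn ℤ (f c i) (f d k) = 0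

variable {P R f}

/-- Projection after embedding is the identity within a block and zero between blocks. This makes
`endHom` multiplicative and `equivHom` injective, without a separate independence hypothesis on the
union of the blocks. -/
theorem AreBlocks.projection_sum (h : AreBlocks P R f) (x : ∀ c, (R c).Coweight) (c : γ) :
    blockProjection P (R c) (f c) (∑ d, blockEmbedding P (R d) (f d) (x d)) = x c := by
  classical
  rw [map_sum, Finset.sum_eq_single c]
  · exact blockProjection_blockEmbedding P (R c) (f c) (h.cartan c) (x c)
  · intro d _ hd
    exact blockProjection_blockEmbedding_eq_zero P (R c) (f c) (R d) (f d)
      (h.orthogonal c d (Ne.symm hd)) (x d)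
  · simp

/-- The action of the product of the Weyl groups of the blocks. -/
def AreBlocks.endHom (h : AreBlocks P R f) :
    (∀ c, weylGroup (R c).base) →* Module.End ℝ N where
  toFun w := LinearMap.id + ∑ c, blockEmbedding P (R c) (f c) ∘ₗ
    (((w c : (R c).Coweight ≃ₗ[ℝ] (R c).Coweight) : (R c).Coweight →ₗ[ℝ] (R c).Coweight) -
      LinearMap.id) ∘ₗ blockProjection P (R c) (f c)
  map_one' := by
    ext a
    simp
  map_mul' w w' := by
    ext a
    simp only [LinearMap.add_apply, LinearMap.id_apply, LinearMap.sum_apply, LinearMap.comp_apply,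
      LinearMap.sub_apply, LinearEquiv.coe_coe, Module.End.mul_apply, Pi.mul_apply,
      Subgroup.coe_mul, LinearEquiv.mul_apply]
    simp_rw [map_add, h.projection_sum (fun c => (w' c : (R c).Coweight ≃ₗ[ℝ] (R c).Coweight)
      (blockProjection P (R c) (f c) a) - blockProjection P (R c) (f c) a)]
    rw [add_assoc, ← Finset.sum_add_distrib]
    congr 1
    refine Finset.sum_congr rfl fun c _ => ?_
    rw [← map_add]
    congr 1
    simp only [map_sub]
    abel

theorem AreBlocks.endHom_apply (h : AreBlocks P R f) (w : ∀ c, weylGroup (R c).base) (a : N) :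
    h.endHom w a = a + ∑ c, blockEmbedding P (R c) (f c)
      ((w c : (R c).Coweight ≃ₗ[ℝ] (R c).Coweight) (blockProjection P (R c) (f c) a) -
        blockProjection P (R c) (f c) a) := by
  simp [endHom]

/-- The action of the product of the Weyl groups of the blocks by linear automorphisms. -/
def AreBlocks.equivHom (h : AreBlocks P R f) : (∀ c, weylGroup (R c).base) →* (N ≃ₗ[ℝ] N) :=
  (LinearMap.GeneralLinearGroup.generalLinearEquiv ℝ N).toMonoidHom.comp h.endHom.toHomUnits

theorem AreBlocks.equivHom_apply (h : AreBlocks P R f) (w : ∀ c, weylGroup (R c).base) (a : N) :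
    h.equivHom w a = h.endHom w a := rfl

theorem AreBlocks.equivHom_injective (h : AreBlocks P R f) :
    Function.Injective h.equivHom := by
  rw [injective_iff_map_eq_one]
  intro w hw
  ext c x
  have h1 := LinearEquiv.congr_fun hw (blockEmbedding P (R c) (f c) x)
  rw [h.equivHom_apply, h.endHom_apply, LinearEquiv.coe_one, id, add_eq_left] at h1
  have h2 := congrArg (blockProjection P (R c) (f c)) h1
  rw [h.projection_sum (fun d => (w d : (R d).Coweight ≃ₗ[ℝ] (R d).Coweight)
      (blockProjection P (R d) (f d) (blockEmbedding P (R c) (f c) x)) -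
        blockProjection P (R d) (f d) (blockEmbedding P (R c) (f c) x)), map_zero,
    blockProjection_blockEmbedding P (R c) (f c) (h.cartan c), sub_eq_zero] at h2
  exact h2

theorem AreBlocks.equivHom_mulSingle [DecidableEq γ] (h : AreBlocks P R f) (c : γ)
    (i : (R c).base.support) :
    h.equivHom (Pi.mulSingle c (simpleReflection (R c).base i)) = P.coreflection (f c i) := by
  ext a
  rw [h.equivHom_apply, h.endHom_apply, Finset.sum_eq_single c]
  · rw [Pi.mulSingle_eq_same]
    change a + blockEmbedding P (R c) (f c) ((R c).rootPairing.coreflection i _ - _) = _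
    rw [coreflection_apply, sub_sub_cancel_left, map_neg, map_smul, blockEmbedding_coroot,
      root'_blockProjection, coreflection_apply, sub_eq_add_neg]
  · intro d _ hd
    rw [Pi.mulSingle_eq_of_ne hd]
    simp
  · simp

theorem AreBlocks.range_equivHom (h : AreBlocks P R f) :
    h.equivHom.range = reflectionSubgroup P {k | ∃ c i, f c i = k} := by
  classical
  apply le_antisymm
  · rintro _ ⟨w, rfl⟩
    rw [← Subgroup.mem_comap]
    refine Subgroup.pi_mem_of_mulSingle_mem w fun c => ?_
    rw [Subgroup.mem_comap]
    refine map_mem_of_simpleReflection_mem (R c).base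
      (h.equivHom.comp (MonoidHom.mulSingle (fun c => weylGroup (R c).base) c)) _ (fun i => ?_) (w c)
    have h1 := h.equivHom_mulSingle c i
    rw [MonoidHom.comp_apply, MonoidHom.mulSingle_apply, h1]
    exact Subgroup.subset_closure ⟨_, ⟨c, i, rfl⟩, rfl⟩
  · rw [reflectionSubgroup, Subgroup.closure_le]
    rintro _ ⟨_, ⟨c, i, rfl⟩, rfl⟩
    exact ⟨_, h.equivHom_mulSingle c i⟩

theorem AreBlocks.card_eq (h : AreBlocks P R f) :
    Nat.card (reflectionSubgroup P {k | ∃ c i, f c i = k}) =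
      ∏ c, Nat.card (weylGroup (R c).base) := by
  rw [← h.range_equivHom, ← Nat.card_pi]
  exact (Nat.card_congr (h.equivHom.ofInjective h.equivHom_injective).toEquiv).symm

end Blocks

variable [Finite ι] [P.IsRootSystem] [P.IsCrystallographic] [P.IsReduced] [P.IsIrreducible]

/-- Nodes in different components have vanishing Cartan integers, since otherwise they would be
joined; so the components form orthogonal blocks. -/
theorem card_reflectionSubgroup_eq_finprod (b : P.Base) (s : Option b.support → ℕ)
    (R : (zeroGraph b s).ConnectedComponent → SimpleRootSystem.{u, v, w})
    (hR : ∀ c, IsDynkinDiagram b s c (R c)) :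
    (Nat.card (reflectionSubgroup P (extendedNode b '' {e | s e = 0})) : ℚ) =
      ∏ᶠ c, (Nat.card (weylGroup (R c).base) : ℚ) := by
  have : Fintype (zeroGraph b s).ConnectedComponent := Fintype.ofFinite _
  choose e he using hR
  have h : AreBlocks P R (fun c i => extendedNode b (e c i).1.1) := by
    refine ⟨fun c i k => he c i k, fun c d hcd i k => ?_⟩
    by_contra h0
    refine hcd ?_
    rw [← (e c i).2, ← (e d k).2]
    refine SimpleGraph.ConnectedComponent.sound (SimpleGraph.Adj.reachable ?_)
    refine ⟨fun h1 => hcd ?_, Or.inl h0⟩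
    rw [← (e c i).2, ← (e d k).2, h1]
  have h1 : extendedNode b '' {e | s e = 0} = {k | ∃ c i, extendedNode b (e c i).1.1 = k} := by
    ext k
    constructor
    · rintro ⟨n, hn, rfl⟩
      refine ⟨(zeroGraph b s).connectedComponentMk ⟨n, hn⟩, (e _).symm ⟨⟨n, hn⟩, rfl⟩, ?_⟩
      rw [Equiv.apply_symm_apply]
    · rintro ⟨c, i, rfl⟩
      exact ⟨_, (e c i).1.2, rfl⟩
  rw [h1, h.card_eq, finprod_eq_prod_of_fintype, Nat.cast_prod]

end Product

/-! ### Building an irreducible root system from a connected set of roots. -/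

section SubPairing

variable {ι : Type u} {M : Type v} {N : Type w} [AddCommGroup M] [Module ℝ M]
  [AddCommGroup N] [Module ℝ N]

/-- The root pairing formed by a set of roots that is closed under its own reflections. -/
def subPairing (P : RootPairing ι ℝ M N) (J : Set ι)
    (hJ : ∀ i ∈ J, ∀ k ∈ J, P.reflectionPerm i k ∈ J) : RootPairing J ℝ M N where
  toLinearMap := P.toLinearMap
  root := (Function.Embedding.subtype _).trans P.root
  coroot := (Function.Embedding.subtype _).trans P.coroot
  root_coroot_two i := P.root_coroot_two i
  reflectionPerm i :=
    { toFun := fun k => ⟨P.reflectionPerm i k, hJ i i.2 k k.2⟩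
      invFun := fun k => ⟨P.reflectionPerm i k, hJ i i.2 k k.2⟩
      left_inv := fun k => Subtype.ext (P.reflectionPerm_self i k)
      right_inv := fun k => Subtype.ext (P.reflectionPerm_self i k) }
  reflectionPerm_root i k := P.reflectionPerm_root i k
  reflectionPerm_coroot i k := P.reflectionPerm_coroot i k

/-- For an invariant subspace, roots outside it are orthogonal to roots inside it. The simple roots
it contains are therefore closed under adjacency; there is at least one, because a root inside pairs
nontrivially with some simple root. By connectedness it contains them all. -/
theorem IsIrreducible.of_base {ι M N : Type*} [AddCommGroup M] [Module ℝ M]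
    [AddCommGroup N] [Module ℝ N] [Finite ι] (Q : RootPairing ι ℝ M N) [Q.IsRootSystem]
    [Q.IsCrystallographic] (b : Q.Base) (hne : b.support.Nonempty)
    (h : ∀ A ⊆ (b.support : Set ι), A.Nonempty →
      (∀ i ∈ A, ∀ k ∈ b.support, Q.pairing i k ≠ 0 → k ∈ A) → A = b.support) :
    Q.IsIrreducible := by
  obtain ⟨i₀, -⟩ := hne
  have : Nonempty ι := ⟨i₀⟩
  have : Nontrivial M := Q.nontrivial
  have : Module.IsReflexive ℝ M := .of_isPerfPair Q.toLinearMap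
  refine IsIrreducible.mk' Q fun q hq hq0 => ?_
  let q' : Q.invtRootSubmodule := ⟨q, Q.mem_invtRootSubmodule_iff.2 hq⟩
  have hker : ∀ k, Q.root k ∉ q → ∀ i, Q.root i ∈ q → Q.pairing i k = 0 := by
    intro k hk i hi
    have := invtRootSubmodule.le_ker_coroot' q' hk hi
    rwa [LinearMap.mem_ker, root_coroot'_eq_pairing] at this
  obtain ⟨j, hj⟩ : ∃ j, Q.root j ∈ q := by
    by_contra! hall
    have := (invtRootSubmodule.eq_bot_iff q').2 hall
    exact hq0 (congrArg Subtype.val this)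
  have hA := h {i | i ∈ b.support ∧ Q.root i ∈ q} (fun i hi => hi.1) (by
    obtain ⟨i, hi, hij⟩ := b.exists_mem_support_pos_pairingIn_ne_zero j
    refine ⟨i, hi, ?_⟩
    by_contra hiq
    have h1 := Q.pairing_eq_zero_iff.1 (hker i hiq j hj)
    rw [← Q.algebraMap_pairingIn ℤ] at h1
    exact hij (by simpa using h1)) (by
    rintro i ⟨-, hi⟩ k hk hik
    refine ⟨hk, ?_⟩
    by_contra hkq
    exact hik (hker k hkq i hi))
  rw [eq_top_iff, ← IsRootSystem.span_root_eq_top (P := Q)]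
  have h2 := b.span_root_support
  rw [RootPairing.rootSpan] at h2
  rw [← h2, Submodule.span_le]
  rintro _ ⟨i, hi, rfl⟩
  rw [← hA] at hi
  exact hi.2

variable {P : RootPairing ι ℝ M N} {J : Set ι}

theorem isCrystallographic_subPairing [P.IsCrystallographic]
    (hJ : ∀ i ∈ J, ∀ k ∈ J, P.reflectionPerm i k ∈ J) :
    (subPairing P J hJ).IsCrystallographic :=
  ⟨fun i k => P.exists_value (S := ℤ) i k⟩

/-- A connected set of linearly independent roots that generates, up to sign, a set of roots closed
under its own reflections is the set of simple roots of an irreducible root system. -/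
theorem exists_simpleRootSystem [Finite ι] [P.IsCrystallographic] [P.IsReduced] {T : Set ι}
    (hJ : ∀ i ∈ J, ∀ k ∈ J, P.reflectionPerm i k ∈ J) (hTJ : T ⊆ J)
    (hne : T.Nonempty) (hli : LinearIndepOn ℝ P.root T)
    (hpos : ∀ i ∈ J, P.root i ∈ AddSubmonoid.closure (P.root '' T) ∨
      -P.root i ∈ AddSubmonoid.closure (P.root '' T))
    (hconn : ∀ A ⊆ T, A.Nonempty → (∀ i ∈ A, ∀ k ∈ T, P.pairing i k ≠ 0 → k ∈ A) → A = T) :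
    ∃ (R : SimpleRootSystem.{u, v, w}) (φ : R.base.support → ι), Function.Injective φ ∧
      Set.range φ = T ∧ ∀ i k, R.base.cartanMatrix i k = P.pairingIn ℤ (φ i) (φ k) := by
  have : Fintype J := Fintype.ofFinite J
  have hcr := isCrystallographic_subPairing hJ
  -- The scalars stay ℝ; the point is that the ambient spaces shrink to the spans of the chosen
  -- roots and coroots, which makes the pairing a root system.
  let Q := (subPairing P J hJ).restrictScalars' ℝ
  have hpairing : ∀ i k, Q.pairing i k = P.pairing i k := fun i k =>
    restrictScalars_pairing (subPairing P J hJ) ℝ i k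
  have hQc : Q.IsCrystallographic :=
    ⟨fun i k => by rw [hpairing]; exact P.exists_value (S := ℤ) i k⟩
  have hroot : ∀ i, (Q.root i : M) = P.root i := fun i => rfl
  have hQr : Q.IsReduced := by
    refine ⟨fun i j h => ?_⟩
    have h1 := IsReduced.eq_or_eq_neg (P := P) i j (fun h2 => h (by
      refine LinearIndependent.of_comp (Submodule.subtype _) ?_
      convert! h2 using 1
      ext k
      fin_cases k <;> rfl))
    exact h1.imp (fun h2 => Subtype.ext h2) (fun h2 => Subtype.ext h2)
  let S : Set J := {x | (x : ι) ∈ T}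
  have himage : (Submodule.subtype _) '' (Q.root '' S) = P.root '' T := by
    ext x
    constructor
    · rintro ⟨_, ⟨i, hi, rfl⟩, rfl⟩
      exact ⟨i, hi, rfl⟩
    · rintro ⟨i, hi, rfl⟩
      exact ⟨_, ⟨⟨i, hTJ hi⟩, hi, rfl⟩, rfl⟩
  have hliQ : LinearIndepOn ℝ Q.root S := by
    refine LinearIndependent.of_comp (Submodule.subtype _) ?_
    exact LinearIndependent.comp hli (fun x : S => ⟨x.1.1, x.2⟩)
      (fun x y h => Subtype.ext (Subtype.ext (Subtype.mk.inj h)))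
  have hclosure : ∀ x, ((Submodule.subtype _ x : M)) ∈ AddSubmonoid.closure (P.root '' T) →
      x ∈ AddSubmonoid.closure (Q.root '' S) := by
    intro x hx
    rw [← himage] at hx
    have h1 := AddMonoidHom.map_mclosure (Submodule.subtype
      (Submodule.span ℝ (Set.range (subPairing P J hJ).root))).toAddMonoidHom (Q.root '' S)
    change _ ∈ AddSubmonoid.closure ((Submodule.subtype _).toAddMonoidHom '' _) at hx
    rw [← h1] at hx
    obtain ⟨y, hy, hyx⟩ := hx
    have h2 : y = x := Subtype.ext hyx
    rwa [← h2]
  let B : Q.Base := Base.mk' Q S hliQ fun i =>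
    (hpos i i.2).imp (fun h => hclosure _ h) (fun h => hclosure _ h)
  have hB : ∀ x, x ∈ B.support ↔ (x : ι) ∈ T := fun x => by
    simp [B, Base.mk', S]
  have hBne : B.support.Nonempty := by
    obtain ⟨i, hi⟩ := hne
    exact ⟨⟨i, hTJ hi⟩, (hB _).2 hi⟩
  have hirr : Q.IsIrreducible := by
    refine IsIrreducible.of_base Q B hBne fun A hA hA0 hA1 => ?_
    have h1 := hconn (Subtype.val '' A) (by
      rintro _ ⟨x, hx, rfl⟩
      exact (hB x).1 (hA hx)) (hA0.image _) (by
      rintro _ ⟨x, hx, rfl⟩ k hk hxk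
      exact ⟨⟨k, hTJ hk⟩, hA1 x hx _ ((hB _).2 hk) (by rwa [hpairing]), rfl⟩)
    ext x
    rw [Finset.mem_coe, hB, ← h1]
    exact ⟨fun hx => ⟨x, hx, rfl⟩, fun ⟨y, hy, hyx⟩ => by rwa [← Subtype.ext hyx]⟩
  refine ⟨{ Index := J, Weight := _, Coweight := _, rootPairing := Q, base := B },
    fun x => x.1.1, ?_, ?_, fun i k => ?_⟩
  · exact fun x y h => Subtype.ext (Subtype.ext h)
  · ext i
    constructor
    · rintro ⟨x, rfl⟩
      exact (hB _).1 x.2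
    · intro hi
      exact ⟨⟨⟨i, hTJ hi⟩, (hB _).2 hi⟩, rfl⟩
  · apply FaithfulSMul.algebraMap_injective ℤ ℝ
    rw [P.algebraMap_pairingIn, ← hpairing]
    exact Q.algebraMap_pairingIn ℤ _ _

end SubPairing

/-! ### Components of the zero-coordinate subdiagram are Dynkin diagrams. -/

section Component

variable {ι : Type u} {M : Type v} {N : Type w} [Finite ι] [AddCommGroup M] [Module ℝ M]
  [AddCommGroup N] [Module ℝ N] {P : RootPairing ι ℝ M N} [P.IsRootSystem] [P.IsCrystallographic]
  [P.IsReduced] [P.IsIrreducible]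

/-- Up to scale the only linear relation among the extended nodes is α_0 + Σ m_i α_i = 0, and none
of its coefficients vanishes. Hence every proper subset of the nodes is independent. -/
theorem eq_zero_of_sum_extendedNode (b : P.Base) (g : Option b.support → ℝ)
    (hg : ∑ e, g e • P.root (extendedNode b e) = 0) {e₀ : Option b.support} (h₀ : g e₀ = 0) :
    g = 0 := by
  classical
  have h1 : ∀ i : b.support, g (some i) = g none * mark b i := by
    intro i
    rw [Fintype.sum_option, root_extendedNode_none] at hg
    have h2 := DFunLike.congr_fun (congrArg b.toWeightBasis.repr hg) i
    simp only [extendedNode, map_add, map_smul, map_neg, map_sum, Base.toWeightBasis_repr_root,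
      Finsupp.add_apply, Finsupp.smul_apply, Finsupp.neg_apply, Finsupp.finsetSum_apply,
      Finsupp.single_apply, smul_eq_mul, map_zero, Finsupp.zero_apply, mul_ite, mul_one,
      mul_zero, Finset.sum_ite_eq', Finset.mem_univ, if_true] at h2
    rw [mark]
    linarith
  have h2 : g none = 0 := by
    rcases e₀ with _ | i
    · exact h₀
    · rw [h1] at h₀
      exact (mul_eq_zero.1 h₀).resolve_right (mark_pos b i).ne'
  ext e
  rcases e with _ | i
  · exact h2
  · rw [h1, h2, zero_mul, Pi.zero_apply]

theorem linearIndependent_extendedNode (b : P.Base) {S : Set (Option b.support)}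
    {e₀ : Option b.support} (h₀ : e₀ ∉ S) :
    LinearIndepOn ℝ (fun e => P.root (extendedNode b e)) S := by
  refine linearIndepOn_iff''.2 fun t g ht hg0 hg e _ => ?_
  have h1 : ∑ e, g e • P.root (extendedNode b e) = 0 := by
    rw [← hg]
    refine (Finset.sum_subset (Finset.subset_univ t) fun e _ he => ?_).symm
    rw [hg0 e he, zero_smul]
  exact congrFun (eq_zero_of_sum_extendedNode b g h1 (hg0 e₀ fun h => h₀ (ht h))) e

theorem mem_closure_of_apply_eq_zero {b : P.Base} {a : N} (ha : a ∈ alcove b) {v : M}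
    (hv : v ∈ rootCone b) (h : P.toLinearMap v a = 0) :
    v ∈ AddSubmonoid.closure (P.root '' (extendedNode b '' {e | wall b e a = 0})) := by
  induction hv using AddSubmonoid.closure_induction with
  | mem x hx =>
    obtain ⟨i, hi, rfl⟩ := hx
    refine AddSubmonoid.subset_closure ⟨i, ⟨some ⟨i, hi⟩, ?_, rfl⟩, rfl⟩
    rw [Set.mem_ofPred_eq, wall_some]
    exact h
  | zero => exact zero_mem _
  | add x y hx hy ihx ihy =>
    have h1 := nonneg_of_mem_rootCone ha.1 hx
    have h2 := nonneg_of_mem_rootCone ha.1 hy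
    rw [map_add, LinearMap.add_apply] at h
    exact add_mem (ihx (by linarith)) (ihy (by linarith))

/-- A root with integral value at a point `a` of the alcove is, up to sign, a sum of roots of walls
that contain `a`. -/
theorem mem_or_neg_mem_closure {b : P.Base} {a : N} (ha : a ∈ alcove b) {i : ι} {k : ℤ}
    (hk : P.root' i a = k) :
    P.root i ∈ AddSubmonoid.closure (P.root '' (extendedNode b '' {e | wall b e a = 0})) ∨
      -P.root i ∈ AddSubmonoid.closure (P.root '' (extendedNode b '' {e | wall b e a = 0})) := by
  have key : ∀ (i : ι) (k : ℤ), P.root' i a = k → P.root i ∈ rootCone b →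
      P.root i ∈ AddSubmonoid.closure (P.root '' (extendedNode b '' {e | wall b e a = 0})) ∨
      -P.root i ∈ AddSubmonoid.closure (P.root '' (extendedNode b '' {e | wall b e a = 0})) := by
    intro i k hk hi
    have h0 : 0 ≤ P.root' i a := nonneg_of_mem_rootCone ha.1 hi
    have h1 := root'_le_one_of_mem_alcove ha i
    rw [hk] at h0 h1
    have h2 : 0 ≤ k := by exact_mod_cast h0
    have h3 : k ≤ 1 := by exact_mod_cast h1
    rcases (by omega : k = 0 ∨ k = 1) with rfl | rfl
    · exact Or.inl (mem_closure_of_apply_eq_zero ha hi (by simpa using hk))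
    -- A positive root α with value 1 at `a` forces ξ to have value 1 too. Then α_0 is the root of a
    -- wall through `a`, ξ - α vanishes at `a`, and -α = α_0 + (ξ - α).
    · refine Or.inr ?_
      have h4 := nonneg_of_mem_rootCone ha.1 (highestRoot_sub_mem b i)
      rw [map_sub, LinearMap.sub_apply, hk] at h4
      have h5 := ha.2
      push_cast at h4
      have h6 : P.root' (highestRoot b) a = 1 := by linarith
      have h7 := mem_closure_of_apply_eq_zero ha (highestRoot_sub_mem b i) (by
        rw [map_sub, LinearMap.sub_apply, hk, h6]
        simp)
      have h8 : P.root (extendedNode b none) ∈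
          AddSubmonoid.closure (P.root '' (extendedNode b '' {e | wall b e a = 0})) := by
        refine AddSubmonoid.subset_closure ⟨_, ⟨none, ?_, rfl⟩, rfl⟩
        rw [Set.mem_ofPred_eq, wall_none, h6, sub_self]
      rw [root_extendedNode_none] at h8
      have h9 := add_mem h8 h7
      rwa [neg_add_eq_sub, sub_sub_cancel_left] at h9
  rcases b.root_mem_or_neg_mem i with hi | hi
  · exact key i k hk hi
  · have h1 := key (P.reflectionPerm i i) (-k) (by
      rw [root'_reflectionPerm_self, hk]
      push_cast
      rfl) (by rwa [root_reflectionPerm_self])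
    rw [root_reflectionPerm_self, neg_neg] at h1
    exact h1.symm

/-- The part of a combination supported outside `T` lies both in the span of `T` and in that of its
complement in `S`, so it vanishes by independence. -/
theorem mem_closure_of_mem_span {κ : Type*} {f : κ → M} {S T : Set κ} (hTS : T ⊆ S)
    (hli : LinearIndepOn ℝ f S) {x : M} (hx : x ∈ AddSubmonoid.closure (f '' S))
    (hx' : x ∈ Submodule.span ℝ (f '' T)) : x ∈ AddSubmonoid.closure (f '' T) := by
  have h1 : f '' S = f '' T ∪ f '' (S \ T) := by
    rw [← Set.image_union, Set.union_sdiff_cancel hTS]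
  rw [h1, AddSubmonoid.closure_union, AddSubmonoid.mem_sup] at hx
  obtain ⟨y, hy, z, hz, rfl⟩ := hx
  have hle : ∀ A : Set M, ∀ w ∈ AddSubmonoid.closure A, w ∈ Submodule.span ℝ A := fun A w hw =>
    (AddSubmonoid.closure_le (S := (Submodule.span ℝ A).toAddSubmonoid)).2
      Submodule.subset_span hw
  rw [← Set.union_sdiff_cancel hTS, linearIndepOn_union_iff Set.disjoint_sdiff_right] at hli
  have h2 : z ∈ Submodule.span ℝ (f '' T) := by
    simpa using sub_mem hx' (hle _ _ hy)
  have h3 := Submodule.disjoint_def.1 hli.2.2 z h2 (hle _ _ hz)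
  rwa [h3, add_zero]

/-- The components of the subdiagram of the walls that contain a point of the alcove are Dynkin
diagrams. -/
theorem exists_isDynkinDiagram {b : P.Base} {a : N} (ha : a ∈ alcove b)
    {s : Option b.support → ℕ} (hs : ∀ e, s e = 0 ↔ wall b e a = 0) {e₀ : Option b.support}
    (h₀ : s e₀ ≠ 0) (c : (zeroGraph b s).ConnectedComponent) :
    ∃ R : SimpleRootSystem.{u, v, w}, IsDynkinDiagram b s c R := by
  set S : Set (Option b.support) := {e | wall b e a = 0}
  have hli : LinearIndepOn ℝ (fun e => P.root (extendedNode b e)) S :=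
    linearIndependent_extendedNode b (e₀ := e₀) (fun h => h₀ ((hs _).2 h))
  set T' : Set (Option b.support) := Subtype.val '' c.supp
  have hTS : T' ⊆ S := by
    rintro _ ⟨e, -, rfl⟩
    exact (hs _).1 e.2
  have hinj : Set.InjOn (extendedNode b) S := fun e he e' he' h =>
    congrArg Subtype.val (hli.injective (a₁ := ⟨e, he⟩) (a₂ := ⟨e', he'⟩) (congrArg P.root h))
  set T : Set ι := extendedNode b '' T' with hT
  -- Integrality at `a` selects the roots of the whole stabilizer, and the span isolates the chosen
  -- component; both conditions survive reflections.
  set J : Set ι := {i | (∃ k : ℤ, P.root' i a = k) ∧ P.root i ∈ Submodule.span ℝ (P.root '' T)}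
  have hJ : ∀ i ∈ J, ∀ k ∈ J, P.reflectionPerm i k ∈ J := by
    rintro i ⟨⟨m, hm⟩, hi⟩ k ⟨⟨n, hn⟩, hk⟩
    refine ⟨⟨n - P.pairingIn ℤ k i * m, ?_⟩, ?_⟩
    · have h := P.algebraMap_pairingIn ℤ k i
      rw [algebraMap_int_eq, eq_intCast] at h
      rw [RootPairing.root', root_reflectionPerm, reflection_apply_root, map_sub, map_smul,
        LinearMap.sub_apply, LinearMap.smul_apply, hm, hn, ← h]
      push_cast
      rfl
    · rw [root_reflectionPerm, reflection_apply_root]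
      exact sub_mem hk (Submodule.smul_mem _ _ hi)
  have hTJ : T ⊆ J := by
    rintro _ ⟨e, he, rfl⟩
    refine ⟨⟨-level e, ?_⟩, Submodule.subset_span ⟨_, ⟨e, he, rfl⟩, rfl⟩⟩
    have h1 : wall b e a = 0 := hTS he
    rw [wall] at h1
    push_cast
    linarith
  have himg : ∀ A : Set (Option b.support),
      P.root '' (extendedNode b '' A) = (fun e => P.root (extendedNode b e)) '' A :=
    fun A => Set.image_image _ _ _
  have hne : T.Nonempty := by
    obtain ⟨e, he⟩ := c.nonempty_supp
    exact ⟨_, _, ⟨e, he, rfl⟩, rfl⟩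
  have hliT : LinearIndepOn ℝ P.root T := by
    have h1 : LinearIndepOn ℝ (fun e => P.root (extendedNode b e)) T' := hli.mono hTS
    exact LinearIndepOn.image_of_comp (extendedNode b) P.root h1
  have hposT : ∀ i ∈ J, P.root i ∈ AddSubmonoid.closure (P.root '' T) ∨
      -P.root i ∈ AddSubmonoid.closure (P.root '' T) := by
    rintro i ⟨⟨k, hk⟩, hi⟩
    rw [hT, himg] at hi ⊢
    have h1 := mem_or_neg_mem_closure ha hk
    rw [himg] at h1
    exact h1.imp (fun h => mem_closure_of_mem_span hTS hli h hi)
      (fun h => mem_closure_of_mem_span hTS hli h (neg_mem hi))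
  have hconn : ∀ A ⊆ T, A.Nonempty → (∀ i ∈ A, ∀ k ∈ T, P.pairing i k ≠ 0 → k ∈ A) →
      A = T := by
    rintro A hAT ⟨_, hA⟩ hclosed
    refine Set.Subset.antisymm hAT ?_
    obtain ⟨_, ⟨e₁, he₁, rfl⟩, rfl⟩ := hAT hA
    have hwalk : ∀ e, (zeroGraph b s).Reachable e₁ e → extendedNode b e.1 ∈ A := by
      intro e he
      rw [SimpleGraph.reachable_iff_reflTransGen] at he
      induction he with
      | refl => exact hA
      | @tail e e' h h' ih =>
        rw [← SimpleGraph.reachable_iff_reflTransGen] at h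
        refine hclosed _ ih _ ⟨_, ⟨e', ?_, rfl⟩, rfl⟩ ?_
        · rw [SimpleGraph.ConnectedComponent.mem_supp_iff] at he₁ ⊢
          rw [← he₁]
          exact (SimpleGraph.ConnectedComponent.sound (h.trans h'.reachable)).symm
        · intro h0
          have h1 := P.pairing_eq_zero_iff.1 h0
          rw [← P.algebraMap_pairingIn ℤ, algebraMap_int_eq, eq_intCast, Int.cast_eq_zero] at h0 h1
          exact h'.2.elim (fun h => h h0) (fun h => h h1)
    rintro _ ⟨_, ⟨e, he, rfl⟩, rfl⟩
    refine hwalk e (SimpleGraph.ConnectedComponent.exact ?_)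
    rw [SimpleGraph.ConnectedComponent.mem_supp_iff] at he he₁
    rw [he, he₁]
  obtain ⟨R, φ, hφ, hφT, hC⟩ := exists_simpleRootSystem (P := P) hJ hTJ hne hliT hposT hconn
  have hmem : ∀ e : c.supp, ∃ i, φ i = extendedNode b e.1.1 := by
    intro e
    have : extendedNode b e.1.1 ∈ Set.range φ := by
      rw [hφT]
      exact ⟨_, ⟨_, e.2, rfl⟩, rfl⟩
    exact this
  choose ψ hψ using hmem
  have hψb : Function.Bijective ψ := by
    constructor
    · intro e e' h
      have h1 : extendedNode b e.1.1 = extendedNode b e'.1.1 := by rw [← hψ, ← hψ, h]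
      exact Subtype.ext (Subtype.ext (hinj ((hs _).1 e.1.2) ((hs _).1 e'.1.2) h1))
    · intro i
      have : φ i ∈ T := by
        rw [← hφT]
        exact ⟨i, rfl⟩
      obtain ⟨_, ⟨e, he, rfl⟩, hei⟩ := this
      exact ⟨⟨e, he⟩, hφ (by rw [hψ, ← hei])⟩
  refine ⟨R, (Equiv.ofBijective ψ hψb).symm, fun i k => ?_⟩
  have h1 : ∀ i, extendedNode b ((Equiv.ofBijective ψ hψb).symm i).1.1 = φ i := by
    intro i
    rw [← hψ]
    congr 1
    exact (Equiv.ofBijective ψ hψb).apply_symm_apply i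
  rw [hC, extendedCartan, Matrix.of_apply, h1, h1]

end Component

/-! ### Dilation and the coweight lattice. -/

section Lattice

variable {ι : Type u} {M : Type v} {N : Type w} [AddCommGroup M] [Module ℝ M]
  [AddCommGroup N] [Module ℝ N] {P : RootPairing ι ℝ M N}

/-- Multiplication by `K` commutes with `g`; this carries the analysis on N / Q^∨ over to N / K Q^∨.
-/
theorem apply_smul_sub_mem_dilate {b : P.Base} {K : ℕ} (hK : 0 < K) (a : N) (g : N ≃ₗ[ℝ] N) :
    g ((K : ℝ) • a) - (K : ℝ) • a ∈ dilate K (corootLattice b) ↔ g a - a ∈ corootLattice b := by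
  have hK' : (K : ℝ) ≠ 0 := by exact_mod_cast hK.ne'
  rw [map_smul, ← smul_sub]
  constructor
  · rintro ⟨q, hq, h⟩
    have h1 : (K : ℝ) • q = (K : ℝ) • (g a - a) := by
      rw [← h, Nat.cast_smul_eq_nsmul]
      rfl
    rwa [← smul_right_injective N hK' h1]
  · exact fun h => ⟨_, h, (Nat.cast_smul_eq_nsmul ℝ K _).symm⟩

theorem coreflection_mem_coweightLattice [P.IsCrystallographic] (b : P.Base) (j : ι) {a : N}
    (ha : a ∈ coweightLattice b) : P.coreflection j a ∈ coweightLattice b := by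
  obtain ⟨z, hz⟩ : ∃ z : ℤ, P.root' j a = z := by
    have h1 : ∀ v ∈ rootCone b, ∃ z : ℤ, P.toLinearMap v a = z := by
      intro v hv
      induction hv using AddSubmonoid.closure_induction with
      | mem x hx => obtain ⟨i, hi, rfl⟩ := hx; exact ha i hi
      | zero => exact ⟨0, by simp⟩
      | add x y _ _ hx hy =>
        obtain ⟨m, hm⟩ := hx
        obtain ⟨n, hn⟩ := hy
        exact ⟨m + n, by rw [map_add, LinearMap.add_apply, hm, hn]; push_cast; rfl⟩
    rcases b.root_mem_or_neg_mem j with hj | hj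
    · exact h1 _ hj
    · obtain ⟨z, hz⟩ := h1 _ hj
      refine ⟨-z, ?_⟩
      rw [map_neg, LinearMap.neg_apply] at hz
      push_cast
      linarith
  rw [coreflection_apply, hz, Int.cast_smul_eq_zsmul]
  refine sub_mem ha (zsmul_mem (fun i _ => ⟨P.pairingIn ℤ i j, ?_⟩) _)
  rw [root'_coroot_eq_pairing, ← P.algebraMap_pairingIn ℤ]
  simp

theorem root'_coordinatePoint [P.IsRootSystem] (b : P.Base) (s : Option b.support → ℕ)
    (i : b.support) :
    P.root' i (coordinatePoint b s) = s (some i) := by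
  classical
  rw [coordinatePoint, map_sum]
  simp_rw [map_smul]
  rw [Finset.sum_congr rfl (fun k _ => by rw [root_fundamentalCoweight b i k])]
  simp

end Lattice

/-! ### Coordinates of grid points and the final count. -/

section Grid

variable {ι : Type u} {M : Type v} {N : Type w} [Finite ι] [AddCommGroup M] [Module ℝ M]
  [AddCommGroup N] [Module ℝ N] {P : RootPairing ι ℝ M N} [P.IsRootSystem] [P.IsCrystallographic]
  [P.IsReduced] [P.IsIrreducible]

/-- The dictionary between coordinates and geometry: a zero coordinate means that the point lies on
that wall, node 0 included. -/
theorem wall_coordinatePoint {b : P.Base} {K : ℕ} (hK : 0 < K) {s : Option b.support → ℕ}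
    (hs : IsCoordinate b K s) (e : Option b.support) :
    wall b e ((1 / K : ℝ) • coordinatePoint b s) = s e / K := by
  have hK' : (K : ℝ) ≠ 0 := by exact_mod_cast hK.ne'
  rcases e with _ | i
  · rw [wall_none, map_smul, root'_highestRoot]
    simp_rw [root'_coordinatePoint, mul_comm (mark b _)]
    rw [IsCoordinate] at hs
    rw [smul_eq_mul]
    field_simp
    linarith
  · rw [wall_some, map_smul, root'_coordinatePoint, smul_eq_mul]
    ring

theorem coordinatePoint_mem_alcove {b : P.Base} {K : ℕ} (hK : 0 < K) {s : Option b.support → ℕ}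
    (hs : IsCoordinate b K s) : (1 / K : ℝ) • coordinatePoint b s ∈ alcove b := by
  rw [mem_alcove_iff_wall]
  intro e
  rw [wall_coordinatePoint hK hs]
  positivity

theorem exists_ne_zero_of_isCoordinate {b : P.Base} {K : ℕ} (hK : 0 < K)
    {s : Option b.support → ℕ} (hs : IsCoordinate b K s) : ∃ e, s e ≠ 0 := by
  by_contra! h
  rw [IsCoordinate] at hs
  simp only [h, Nat.cast_zero, zero_mul, Finset.sum_const_zero, add_zero] at hs
  exact hK.ne (by exact_mod_cast hs)

theorem exists_isCoordinate {b : P.Base} {K : ℕ} (hK : 0 < K) {a : N} (ha : a ∈ alcove b)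
    (haK : K • a ∈ coweightLattice b) :
    ∃ s, IsCoordinate b K s ∧ (1 / K : ℝ) • coordinatePoint b s = a := by
  have hK' : (K : ℝ) ≠ 0 := by exact_mod_cast hK.ne'
  have h1 : ∀ i : b.support, ∃ n : ℕ, K * P.root' i a = n := by
    intro i
    obtain ⟨z, hz⟩ := haK i i.2
    rw [map_nsmul, nsmul_eq_mul] at hz
    have h2 : (0 : ℝ) ≤ z := by
      rw [← hz]
      exact mul_nonneg K.cast_nonneg (ha.1 i i.2)
    obtain ⟨n, rfl⟩ := Int.eq_ofNat_of_zero_le (a := z) (by exact_mod_cast h2)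
    exact ⟨n, by rw [hz]; simp⟩
  choose n hn using h1
  choose m _ hm using exists_nat_mark b
  have h3 : K * P.root' (highestRoot b) a = (∑ i, n i * m i : ℕ) := by
    rw [root'_highestRoot, Finset.mul_sum]
    push_cast
    refine Finset.sum_congr rfl fun i _ => ?_
    rw [← hn, ← hm]
    ring
  have h4 : ∑ i, n i * m i ≤ K := by
    have : (K : ℝ) * P.root' (highestRoot b) a ≤ K * 1 :=
      mul_le_mul_of_nonneg_left ha.2 K.cast_nonneg
    rw [h3, mul_one] at this
    exact_mod_cast this
  -- The coordinate at node 0 is the slack in ⟨ξ, a⟩ ≤ 1 after multiplication by `K`, a natural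
  -- number because the marks are.
  obtain ⟨k, hk⟩ := Nat.exists_eq_add_of_le h4
  refine ⟨fun e => e.elim k n, ?_, ?_⟩
  · rw [IsCoordinate, hk]
    simp_rw [hm]
    push_cast
    simp only [Option.elim]
    ring
  · refine ext_of_root'_eq b fun i hi => ?_
    rw [map_smul, root'_coordinatePoint b _ ⟨i, hi⟩, smul_eq_mul]
    simp only [Option.elim]
    rw [← hn]
    field_simp

theorem eq_one_of_apply_sub_mem {b : P.Base} {a : N} (ha : a ∈ openAlcove b) {g : N ≃ₗ[ℝ] N}
    (hg : g ∈ weylGroup b) (hga : g a - a ∈ corootLattice b) : g = 1 := by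
  have h1 := (mem_reflectionSubgroup_iff (openAlcove_subset_alcove b ha) g).1 ⟨hg, hga⟩
  have h2 : {e | wall b e a = 0} = ∅ := by
    ext e
    simpa using ((mem_openAlcove_iff_wall b a).1 ha e).ne'
  rw [h2, Set.image_empty, reflectionSubgroup, Set.image_empty, Subgroup.closure_empty] at h1
  exact Subgroup.mem_bot.1 h1

/-- The order of the stabilizer in the even Weyl group of a point `p` that is fixed by the same
elements as a point `a` of the alcove. -/
theorem evenStabOrder_of_alcove {b : P.Base} {L : AddSubgroup N} (hL : IsStable b L) {p a : N}
    (ha : a ∈ alcove b) (hpa : ∀ g : N ≃ₗ[ℝ] N, g p - p ∈ L ↔ g a - a ∈ corootLattice b)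
    {s : Option b.support → ℕ} (hs : ∀ e, s e = 0 ↔ wall b e a = 0) (h₀ : ∃ e, s e ≠ 0) :
    ((∀ e, s e ≠ 0) → evenStabOrder hL (p : N ⧸ L) = 1) ∧
      ((∃ e, s e = 0) →
        (∀ c : (zeroGraph b s).ConnectedComponent,
          ∃ R : SimpleRootSystem.{u, v, w}, IsDynkinDiagram b s c R) ∧
        ∀ R : (zeroGraph b s).ConnectedComponent → SimpleRootSystem.{u, v, w},
          (∀ c, IsDynkinDiagram b s c (R c)) →
          (evenStabOrder hL (p : N ⧸ L) : ℚ) =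
            1 / 2 * ∏ᶠ c, (Nat.card (weylGroup (R c).base) : ℚ)) := by
  have : FiniteDimensional ℝ N := Module.Finite.of_basis b.toCoweightBasis
  constructor
  · intro h
    have ha' : a ∈ openAlcove b := by
      rw [mem_openAlcove_iff_wall]
      intro e
      exact lt_of_le_of_ne ((mem_alcove_iff_wall b a).1 ha e) fun h1 => h e ((hs e).2 h1.symm)
    -- The case of the identity element, whose torus map acts trivially.
    have h1 := evenStabOrder_torusMap hL 1 p
      (fun g hg hgp => eq_one_of_apply_sub_mem ha' hg ((hpa g).1 hgp))
    exact h1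
  · rintro ⟨e₁, he₁⟩
    obtain ⟨e₀, he₀⟩ := h₀
    refine ⟨exists_isDynkinDiagram ha hs he₀, fun R hR => ?_⟩
    rw [evenStabOrder_eq_card hL p (fun g => by rw [hpa, mem_reflectionSubgroup_iff ha]),
      ← card_reflectionSubgroup_eq_finprod b s R hR]
    have h1 : {e | s e = 0} = {e | wall b e a = 0} := Set.ext hs
    rw [h1, card_reflectionSubgroup (Set.Nonempty.image _ ⟨e₁, (hs _).1 he₁⟩)]
    push_cast
    ring

theorem stabilizer_pointGrid (b : P.Base) (j : b.support) {K : ℕ} (hK : 0 < K)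
    (x : N ⧸ corootLattice b) (hx : x ∈ pointGrid b K (evenAlcove b j)) :
    (x ∈ pointGrid b K (alcove b) ∨ x ∈ reflectedPointGrid b K j) ∧
    (x ∈ reflectedPointGrid b K j → hEven b x = 1) ∧
    (x ∈ pointGrid b K (alcove b) →
      (∃ s, IsPointCoordinate b K s x) ∧
      ∀ s, IsPointCoordinate b K s x →
        ((∀ i, s i ≠ 0) → hEven b x = 1) ∧
        ((∃ i, s i = 0) →
          (∀ c : (zeroGraph b s).ConnectedComponent,
            ∃ R : SimpleRootSystem.{u, v, w}, IsDynkinDiagram b s c R) ∧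
          ∀ R : (zeroGraph b s).ConnectedComponent → SimpleRootSystem.{u, v, w},
            (∀ c, IsDynkinDiagram b s c (R c)) →
            (hEven b x : ℚ) = 1 / 2 * ∏ᶠ c, (Nat.card (weylGroup (R c).base) : ℚ))) := by
  have hK' : (K : ℝ) ≠ 0 := by exact_mod_cast hK.ne'
  refine ⟨?_, ?_, ?_⟩
  · obtain ⟨_, ha, ha' | ⟨a, ha', rfl⟩, rfl⟩ := hx
    · exact Or.inl ⟨_, ha, ha', rfl⟩
    · refine Or.inr ⟨_, ⟨a, ?_, ha', rfl⟩, rfl⟩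
      have h1 : K • P.coreflection j a ∈ coweightLattice b := ha
      have h2 := coreflection_mem_coweightLattice b j h1
      rw [map_nsmul, coreflection_same] at h2
      exact h2
  · rintro ⟨_, ⟨a, -, ha, rfl⟩, rfl⟩
    exact evenStabOrder_torusMap _ _ a fun g hg hga => eq_one_of_apply_sub_mem ha hg hga
  · rintro ⟨a, haK, ha, rfl⟩
    constructor
    · obtain ⟨s, hs, h⟩ := exists_isCoordinate hK ha haK
      exact ⟨s, hs, by rw [h]⟩
    · rintro s ⟨hs, h⟩
      -- The coordinates need not come from the representative `a`. Passing to the coordinate point,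
      -- itself in the alcove, avoids any uniqueness of representatives.
      rw [h]
      exact evenStabOrder_of_alcove _ (coordinatePoint_mem_alcove hK hs) (fun g => Iff.rfl)
        (fun e => by rw [wall_coordinatePoint hK hs]; simp [hK.ne'])
        (exists_ne_zero_of_isCoordinate hK hs)

theorem stabilizer_weightGrid (b : P.Base) (j : b.support) {K : ℕ} (hK : 0 < K)
    (x : N ⧸ dilate K (corootLattice b)) (hx : x ∈ weightGrid b K (evenAlcove b j)) :
    (x ∈ weightGrid b K (alcove b) ∨ x ∈ reflectedWeightGrid b K j) ∧
    (x ∈ reflectedWeightGrid b K j → hEvenWeight b K x = 1) ∧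
    (x ∈ weightGrid b K (alcove b) →
      (∃ t, IsWeightCoordinate b K t x) ∧
      ∀ t, IsWeightCoordinate b K t x →
        ((∀ i, t i ≠ 0) → hEvenWeight b K x = 1) ∧
        ((∃ i, t i = 0) →
          (∀ c : (zeroGraph b t).ConnectedComponent,
            ∃ R : SimpleRootSystem.{u, v, w}, IsDynkinDiagram b t c R) ∧
          ∀ R : (zeroGraph b t).ConnectedComponent → SimpleRootSystem.{u, v, w},
            (∀ c, IsDynkinDiagram b t c (R c)) →
            (hEvenWeight b K x : ℚ) =
              1 / 2 * ∏ᶠ c, (Nat.card (weylGroup (R c).base) : ℚ))) := by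
  have hK' : (K : ℝ) ≠ 0 := by exact_mod_cast hK.ne'
  have hcancel : ∀ c : N, (K : ℝ) • (1 / K : ℝ) • c = c := fun c => by
    rw [smul_smul, mul_one_div_cancel hK', one_smul]
  refine ⟨?_, ?_, ?_⟩
  · obtain ⟨_, hp, ⟨_, ha' | ⟨a, ha', rfl⟩, rfl⟩, rfl⟩ := hx
    · exact Or.inl ⟨_, hp, ⟨_, ha', rfl⟩, rfl⟩
    · have h1 := coreflection_mem_coweightLattice b j hp
      simp only [map_smul, coreflection_same] at h1
      refine Or.inr ⟨_, ⟨_, h1, ⟨a, ha', rfl⟩, rfl⟩, ?_⟩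
      change ((P.coreflection j ((K : ℝ) • a) : N) : N ⧸ dilate K (corootLattice b)) = _
      rw [map_smul]
  · rintro ⟨_, ⟨_, -, ⟨a, ha, rfl⟩, rfl⟩, rfl⟩
    exact evenStabOrder_torusMap _ _ _ fun g hg hga =>
      eq_one_of_apply_sub_mem ha hg ((apply_smul_sub_mem_dilate hK a g).1 hga)
  · rintro ⟨_, hp, ⟨a, ha, rfl⟩, rfl⟩
    constructor
    · have h1 : K • a ∈ coweightLattice b := by
        rw [← Nat.cast_smul_eq_nsmul ℝ]
        exact hp
      obtain ⟨t, ht, h⟩ := exists_isCoordinate hK ha h1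
      exact ⟨t, ht, by simp only [← h, hcancel]⟩
    · rintro t ⟨ht, h⟩
      rw [h]
      refine evenStabOrder_of_alcove _ (coordinatePoint_mem_alcove hK ht) (fun g => ?_)
        (fun e => by rw [wall_coordinatePoint hK ht]; simp [hK.ne'])
        (exists_ne_zero_of_isCoordinate hK ht)
      -- The alcove point is the coordinate point divided by `K`.
      rw [← apply_smul_sub_mem_dilate hK, hcancel]

end Grid

end

end EvenTorus

/-- Flipping the pairing exchanges roots with coroots and keeps all hypotheses, so the dual half is
the weight-grid statement for `b.flip`. -/
theorem mainTheorem7 {ι : Type u} {M : Type v} {N : Type w} [Finite ι]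
    [AddCommGroup M] [Module ℝ M] [AddCommGroup N] [Module ℝ N]
    (P : RootPairing ι ℝ M N) [P.IsRootSystem] [P.IsCrystallographic] [P.IsReduced]
    [P.IsIrreducible] (b : P.Base) (j : b.support) (K : ℕ) (hK : 0 < K) :
    (∀ x ∈ EvenTorus.pointGrid b K (EvenTorus.evenAlcove b j),
      (x ∈ EvenTorus.pointGrid b K (EvenTorus.alcove b) ∨
        x ∈ EvenTorus.reflectedPointGrid b K j) ∧
      (x ∈ EvenTorus.reflectedPointGrid b K j → EvenTorus.hEven b x = 1) ∧
      (x ∈ EvenTorus.pointGrid b K (EvenTorus.alcove b) →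
        (∃ s, EvenTorus.IsPointCoordinate b K s x) ∧
        ∀ s, EvenTorus.IsPointCoordinate b K s x →
          ((∀ i, s i ≠ 0) → EvenTorus.hEven b x = 1) ∧
          ((∃ i, s i = 0) →
            (∀ c : (EvenTorus.zeroGraph b s).ConnectedComponent,
              ∃ R : EvenTorus.SimpleRootSystem.{u, v, w}, EvenTorus.IsDynkinDiagram b s c R) ∧
            ∀ R : (EvenTorus.zeroGraph b s).ConnectedComponent →
                EvenTorus.SimpleRootSystem.{u, v, w},
              (∀ c, EvenTorus.IsDynkinDiagram b s c (R c)) →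
              (EvenTorus.hEven b x : ℚ) =
                1 / 2 * ∏ᶠ c, (Nat.card (EvenTorus.weylGroup (R c).base) : ℚ)))) ∧
    (∀ l ∈ EvenTorus.weightGrid b.flip K (EvenTorus.evenAlcove b.flip j),
      (l ∈ EvenTorus.weightGrid b.flip K (EvenTorus.alcove b.flip) ∨
        l ∈ EvenTorus.reflectedWeightGrid b.flip K j) ∧
      (l ∈ EvenTorus.reflectedWeightGrid b.flip K j → EvenTorus.hEvenWeight b.flip K l = 1) ∧
      (l ∈ EvenTorus.weightGrid b.flip K (EvenTorus.alcove b.flip) →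
        (∃ t, EvenTorus.IsWeightCoordinate b.flip K t l) ∧
        ∀ t, EvenTorus.IsWeightCoordinate b.flip K t l →
          ((∀ i, t i ≠ 0) → EvenTorus.hEvenWeight b.flip K l = 1) ∧
          ((∃ i, t i = 0) →
            (∀ c : (EvenTorus.zeroGraph b.flip t).ConnectedComponent,
              ∃ R : EvenTorus.SimpleRootSystem.{u, w, v},
                EvenTorus.IsDynkinDiagram b.flip t c R) ∧
            ∀ R : (EvenTorus.zeroGraph b.flip t).ConnectedComponent →
                EvenTorus.SimpleRootSystem.{u, w, v},
              (∀ c, EvenTorus.IsDynkinDiagram b.flip t c (R c)) →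
              (EvenTorus.hEvenWeight b.flip K l : ℚ) =
                1 / 2 * ∏ᶠ c, (Nat.card (EvenTorus.weylGroup (R c).base) : ℚ)))) :=
  ⟨EvenTorus.stabilizer_pointGrid b j hK, EvenTorus.stabilizer_weightGrid b.flip j hK⟩
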